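/- Let $r \geqslant 3$ be an integer, let $q = e^{2\pi i/r}$, and set $r' = r/\gcd(r,2)$, $r'' = r/\gcd(r,4)$, $\{n\} = q^n - q^{-n}$, $[n] = \{n\}/\{1\}$, $[n]! = [n][n-1]\cdots[1]$. Let $u_q\mathfrak{sl}_2$ be the $\mathbb{C}$-algebra with generators $K, K^{-1}, E, F$ and relations $$KK^{-1} = K^{-1}K = 1,\quad KEK^{-1} = q^2E,\quad KFK^{-1} = q^{-2}F,\quad EF - FE = \frac{K-K^{-1}}{q-q^{-1}},\quad K^{r'} = 1,\quad E^{r'} = F^{r'} = 0,$$ made into a Hopf algebra by $\Delta(K) = K \otimes K$, $\Delta(E) = E \otimes K + 1 \otimes E$, $\Delta(F) = F \otimes 1 + K^{-1} \otimes F$, $\varepsilon(K) = 1$, $\varepsilon(E) = \varepsilon(F) = 0$, $S(K) = K^{-1}$, $S(E) = -EK^{-1}$, $S(F) = -KF$. Consider its R-matrix $$R = \sum_i R'_i \otimes R''_i = \frac{1}{r'} \sum_{a,b,c=0}^{r'-1} \frac{\{1\}^a}{[a]!}\, q^{\frac{a(a-1)}{2}-2bc}\, K^bE^a \otimes K^cF^a,$$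 the Drinfeld element $u = \sum_i S(R''_i)R'_i$, the pivotal element $g = K$, and the ribbon element $v_+ = g^{-1}u$. Then $v_+$ is invertible, and $v_+$ and its inverse $v_-$ (which therefore satisfies $g = uv_-$) are given as follows. If $r \equiv 1 \bmod 2$, then $$v_+ = \frac{i^{\frac{r-1}{2}}}{\sqrt{r}} \sum_{a,b=0}^{r-1} \frac{\{-1\}^a}{[a]!}\, q^{-\frac{(a+3)a}{2}+\frac{r+1}{2}(b+1)^2} F^aE^aK^{-a+b},$$ $$v_- = \frac{i^{-\frac{r-1}{2}}}{\sqrt{r}} \sum_{a,b=0}^{r-1} \frac{\{1\}^a}{[a]!}\, q^{\frac{(a+3)a}{2}-\frac{r+1}{2}(b-1)^2} F^aE^aK^{a+b}.$$ If $r \equiv 2 \bmod 4$, then, with $\left(\frac{2}{r'}\right)$ the Jacobi symbol, $$v_+ = \left(\frac{2}{r'}\right) \frac{i^{\frac{r'-1}{2}}}{\sqrt{r'}} \sum_{a,b=0}^{r'-1} \frac{\{-1\}^a}{[a]!}\, q^{-\frac{(a+3)a}{2}+\frac{(r'+1)^2}{2}(b+1)^2} F^aE^aK^{-a+b},$$ $$v_-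 = \left(\frac{2}{r'}\right) \frac{i^{-\frac{r'-1}{2}}}{\sqrt{r'}} \sum_{a,b=0}^{r'-1} \frac{\{1\}^a}{[a]!}\, q^{\frac{(a+3)a}{2}-\frac{(r'+1)^2}{2}(b-1)^2} F^aE^aK^{a+b}.$$ If $r \equiv 4 \bmod 8$, then $$v_+ = \frac{i^{\frac{r''-1}{2}}}{\sqrt{r''}} \sum_{a=0}^{r'-1} \sum_{b=0}^{r''-1} \frac{\{-1\}^a}{[a]!}\, q^{-\frac{(a+3)a}{2}+\frac{(r''+1)^3}{2}(2b+1)^2} F^aE^aK^{-a+2b},$$ $$v_- = \frac{i^{-\frac{r''-1}{2}}}{\sqrt{r''}} \sum_{a=0}^{r'-1} \sum_{b=0}^{r''-1} \frac{\{1\}^a}{[a]!}\, q^{\frac{(a+3)a}{2}-\frac{(r''+1)^3}{2}(2b-1)^2} F^aE^aK^{a+2b}.$$ If $r \equiv 0 \bmod 8$, write $r = 2^k s$ with $k \geqslant 3$ and $s$ odd, and let $\psi \in \mathbb{N}$ be any number with $s\psi \equiv 1 \bmod 2^{k-1}$; then $$v_+ = \frac{1-i}{\sqrt{2}\sqrt{r''}}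 \sum_{a=0}^{r'-1} \sum_{b=0}^{s-1} \sum_{m=0}^{2^{k-2}-1} \frac{\{-1\}^a}{[a]!}\, q^{-\frac{(a+3)a}{2}+2(s\psi+(s+1)^{k+1})(2^{k-2}b+m)^2} F^aE^aK^{-a+2^{k-1}b+2m-1},$$ $$v_- = \frac{1+i}{\sqrt{2}\sqrt{r''}} \sum_{a=0}^{r'-1} \sum_{b=0}^{s-1} \sum_{m=0}^{2^{k-2}-1} \frac{\{1\}^a}{[a]!}\, q^{\frac{(a+3)a}{2}-2(s\psi+(s+1)^{k+1})(2^{k-2}b+m)^2} F^aE^aK^{a+2^{k-1}b+2m+1}.$$ -/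

import Mathlib

open scoped TensorProduct

noncomputable section

namespace SmallQuantum

/-! ### Quantum integers at a root of unity -/

/-- The root of unity `q = e^{2πi/r}`. -/
def q (r : ℕ) : ℂ := Complex.exp (2 * Real.pi * Complex.I / r)

/-- `r' = r / gcd(r, 2)`. -/
def r₁ (r : ℕ) : ℕ := r / Nat.gcd r 2

/-- `r'' = r / gcd(r, 4)`. -/
def r₂ (r : ℕ) : ℕ := r / Nat.gcd r 4

/-- The quantum bracket `{n} = q^n - q^{-n}`. -/
def brace (r : ℕ) (n : ℤ) : ℂ := q r ^ n - q r ^ (-n)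

/-- The quantum integer `[n] = {n} / {1}`. -/
def qInt (r : ℕ) (n : ℤ) : ℂ := brace r n / brace r 1

/-- The quantum factorial `[n]! = [n][n-1]⋯[1]`. -/
def qFact (r : ℕ) (n : ℕ) : ℂ := ∏ j ∈ Finset.range n, qInt r ((j : ℤ) + 1)

/-! ### The algebra -/

/-- The generators of `u_q sl₂`. -/
inductive Gen
  | K | Kinv | E | F

/-- The defining relations of `u_q sl₂`. -/
inductive Rel (r : ℕ) : FreeAlgebra ℂ Gen → FreeAlgebra ℂ Gen → Prop
  | K_Kinv : Rel r (FreeAlgebra.ι ℂ Gen.K * FreeAlgebra.ι ℂ Gen.Kinv) 1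
  | Kinv_K : Rel r (FreeAlgebra.ι ℂ Gen.Kinv * FreeAlgebra.ι ℂ Gen.K) 1
  | K_E : Rel r
      (FreeAlgebra.ι ℂ Gen.K * FreeAlgebra.ι ℂ Gen.E * FreeAlgebra.ι ℂ Gen.Kinv)
      (q r ^ (2 : ℤ) • FreeAlgebra.ι ℂ Gen.E)
  | K_F : Rel r
      (FreeAlgebra.ι ℂ Gen.K * FreeAlgebra.ι ℂ Gen.F * FreeAlgebra.ι ℂ Gen.Kinv)
      (q r ^ (-2 : ℤ) • FreeAlgebra.ι ℂ Gen.F)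
  | E_F : Rel r
      (FreeAlgebra.ι ℂ Gen.E * FreeAlgebra.ι ℂ Gen.F
        - FreeAlgebra.ι ℂ Gen.F * FreeAlgebra.ι ℂ Gen.E)
      ((q r - (q r)⁻¹)⁻¹ • (FreeAlgebra.ι ℂ Gen.K - FreeAlgebra.ι ℂ Gen.Kinv))
  | K_pow : Rel r (FreeAlgebra.ι ℂ Gen.K ^ r₁ r) 1
  | E_pow : Rel r (FreeAlgebra.ι ℂ Gen.E ^ r₁ r) 0
  | F_pow : Rel r (FreeAlgebra.ι ℂ Gen.F ^ r₁ r) 0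

end SmallQuantum

open SmallQuantum in
/-- The small quantum group `u_q sl₂` at `q = e^{2πi/r}`, by generators and relations. -/
def SmallQuantumSl2 (r : ℕ) : Type := RingQuot (Rel r)

namespace SmallQuantum

instance (r : ℕ) : Ring (SmallQuantumSl2 r) := inferInstanceAs (Ring (RingQuot (Rel r)))

instance (r : ℕ) : Algebra ℂ (SmallQuantumSl2 r) :=
  inferInstanceAs (Algebra ℂ (RingQuot (Rel r)))

/-- The image of a generator in `u_q sl₂`. -/
def gen (r : ℕ) (x : Gen) : SmallQuantumSl2 r :=
  RingQuot.mkAlgHom ℂ (Rel r) (FreeAlgebra.ι ℂ x)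

/-- The generator `E`. -/
def E (r : ℕ) : SmallQuantumSl2 r := gen r Gen.E

/-- The generator `F`. -/
def F (r : ℕ) : SmallQuantumSl2 r := gen r Gen.F

theorem gen_K_Kinv (r : ℕ) : gen r Gen.K * gen r Gen.Kinv = 1 := by
  simpa [gen] using! RingQuot.mkAlgHom_rel ℂ (Rel.K_Kinv (r := r))

theorem gen_Kinv_K (r : ℕ) : gen r Gen.Kinv * gen r Gen.K = 1 := by
  simpa [gen] using! RingQuot.mkAlgHom_rel ℂ (Rel.Kinv_K (r := r))

/-- The generator `K`, as a unit with inverse the generator `K⁻¹`. -/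
def K (r : ℕ) : (SmallQuantumSl2 r)ˣ :=
  ⟨gen r Gen.K, gen r Gen.Kinv, gen_K_Kinv r, gen_Kinv_K r⟩

theorem gen_K_E (r : ℕ) :
    gen r Gen.K * gen r Gen.E * gen r Gen.Kinv = q r ^ (2 : ℤ) • gen r Gen.E := by
  simpa [gen] using! RingQuot.mkAlgHom_rel ℂ (Rel.K_E (r := r))

theorem gen_K_F (r : ℕ) :
    gen r Gen.K * gen r Gen.F * gen r Gen.Kinv = q r ^ (-2 : ℤ) • gen r Gen.F := by
  simpa [gen] using! RingQuot.mkAlgHom_rel ℂ (Rel.K_F (r := r))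

theorem gen_E_F (r : ℕ) :
    gen r Gen.E * gen r Gen.F - gen r Gen.F * gen r Gen.E
      = (q r - (q r)⁻¹)⁻¹ • (gen r Gen.K - gen r Gen.Kinv) := by
  simpa [gen] using! RingQuot.mkAlgHom_rel ℂ (Rel.E_F (r := r))

theorem gen_K_pow (r : ℕ) : gen r Gen.K ^ r₁ r = 1 := by
  simpa [gen] using! RingQuot.mkAlgHom_rel ℂ (Rel.K_pow (r := r))

theorem gen_E_pow (r : ℕ) : gen r Gen.E ^ r₁ r = 0 := by
  simpa [gen] using! RingQuot.mkAlgHom_rel ℂ (Rel.E_pow (r := r))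

theorem gen_F_pow (r : ℕ) : gen r Gen.F ^ r₁ r = 0 := by
  simpa [gen] using! RingQuot.mkAlgHom_rel ℂ (Rel.F_pow (r := r))

/-- The universal property of `u_q sl₂`. -/
def lift (r : ℕ) {A : Type*} [Ring A] [Algebra ℂ A] (k k' e f : A)
    (h1 : k * k' = 1) (h2 : k' * k = 1)
    (h3 : k * e * k' = q r ^ (2 : ℤ) • e) (h4 : k * f * k' = q r ^ (-2 : ℤ) • f)
    (h5 : e * f - f * e = (q r - (q r)⁻¹)⁻¹ • (k - k'))
    (h6 : k ^ r₁ r = 1) (h7 : e ^ r₁ r = 0) (h8 : f ^ r₁ r = 0) :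
    SmallQuantumSl2 r →ₐ[ℂ] A :=
  RingQuot.liftAlgHom ℂ
    ⟨FreeAlgebra.lift ℂ fun
        | Gen.K => k
        | Gen.Kinv => k'
        | Gen.E => e
        | Gen.F => f,
      by
        intro x y h
        cases h
        case K_Kinv => simpa using h1
        case Kinv_K => simpa using h2
        case K_E => simpa using h3
        case K_F => simpa using h4
        case E_F => simpa using h5
        case K_pow => simpa using h6
        case E_pow => simpa using h7
        case F_pow => simpa using h8⟩

theorem lift_gen (r : ℕ) {A : Type*} [Ring A] [Algebra ℂ A] (k k' e f : A)
    (h1 : k * k' = 1) (h2 : k' * k = 1)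
    (h3 : k * e * k' = q r ^ (2 : ℤ) • e) (h4 : k * f * k' = q r ^ (-2 : ℤ) • f)
    (h5 : e * f - f * e = (q r - (q r)⁻¹)⁻¹ • (k - k'))
    (h6 : k ^ r₁ r = 1) (h7 : e ^ r₁ r = 0) (h8 : f ^ r₁ r = 0) :
    lift r k k' e f h1 h2 h3 h4 h5 h6 h7 h8 (gen r Gen.K) = k ∧
    lift r k k' e f h1 h2 h3 h4 h5 h6 h7 h8 (gen r Gen.Kinv) = k' ∧
    lift r k k' e f h1 h2 h3 h4 h5 h6 h7 h8 (gen r Gen.E) = e ∧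
    lift r k k' e f h1 h2 h3 h4 h5 h6 h7 h8 (gen r Gen.F) = f := by
  refine ⟨?_, ?_, ?_, ?_⟩ <;>
  · unfold lift gen
    erw [RingQuot.liftAlgHom_mkAlgHom_apply]
    simp

theorem hom_ext {r : ℕ} {A : Type*} [Semiring A] [Algebra ℂ A]
    {φ ψ : SmallQuantumSl2 r →ₐ[ℂ] A} (h : ∀ x, φ (gen r x) = ψ (gen r x)) : φ = ψ := by
  refine RingQuot.ringQuot_ext' (S := ℂ) (s := Rel r) φ ψ ?_
  ext x
  exact h x

theorem induction {r : ℕ} {P : SmallQuantumSl2 r → Prop}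
    (hC : ∀ c : ℂ, P (algebraMap ℂ _ c)) (hgen : ∀ x, P (gen r x))
    (hadd : ∀ x y, P x → P y → P (x + y)) (hmul : ∀ x y, P x → P y → P (x * y))
    (x : SmallQuantumSl2 r) : P x := by
  obtain ⟨y, rfl⟩ := RingQuot.mkAlgHom_surjective ℂ (Rel r) x
  induction y using FreeAlgebra.induction with
  | grade0 c =>
    exact (congrArg P (AlgHom.commutes (RingQuot.mkAlgHom ℂ (Rel r)) c)).mpr (hC c)
  | grade1 x => exact hgen x
  | mul a b ha hb => rw [map_mul]; exact hmul _ _ ha hb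
  | add a b ha hb => rw [map_add]; exact hadd _ _ ha hb

/-! ### Powers of sums and products of `q`-commuting elements -/

/-- Gaussian binomial coefficients. -/
def gauss (t : ℂ) : ℕ → ℕ → ℂ
  | _, 0 => 1
  | 0, _ + 1 => 0
  | m + 1, k + 1 => gauss t m k + t ^ (k + 1) * gauss t m (k + 1)

theorem gauss_mul (t : ℂ) (m k : ℕ) :
    gauss t m k * ∏ j ∈ Finset.range k, (1 - t ^ (j + 1))
      = ∏ j ∈ Finset.range k, (1 - t ^ (m - j)) := by
  induction m generalizing k with
  | zero =>
    cases k with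
    | zero => simp [gauss]
    | succ k => simp [gauss]
  | succ m ih =>
    cases k with
    | zero => simp [gauss]
    | succ k =>
      have h1 := ih k
      have h2 := ih (k + 1)
      rw [Finset.prod_range_succ, Finset.prod_range_succ] at h2
      rw [Finset.prod_range_succ, Finset.prod_range_succ']
      have h3 : ∏ j ∈ Finset.range k, (1 - t ^ (m + 1 - (j + 1)))
          = ∏ j ∈ Finset.range k, (1 - t ^ (m - j)) := by
        refine Finset.prod_congr rfl fun j _ => ?_
        rw [Nat.add_sub_add_right]
      rw [h3, gauss]
      rcases le_or_gt k m with hk | hk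
      · have h4 : t ^ (k + 1) * t ^ (m - k) = t ^ (m + 1) := by
          rw [← pow_add]; congr 1; omega
        rw [Nat.sub_zero]
        linear_combination (1 - t ^ (k + 1)) * h1 + t ^ (k + 1) * h2
          - (∏ j ∈ Finset.range k, (1 - t ^ (m - j))) * h4
      · have h4 : ∏ j ∈ Finset.range k, (1 - t ^ (m - j)) = 0 :=
          Finset.prod_eq_zero (Finset.mem_range.2 hk) (by simp)
        rw [h4] at h1 h2 ⊢
        linear_combination (1 - t ^ (k + 1)) * h1 + t ^ (k + 1) * h2

theorem gauss_eq_zero {t : ℂ} {n k : ℕ} (ht : IsPrimitiveRoot t n) (hk : 0 < k) (hkn : k < n) :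
    gauss t n k = 0 := by
  have h := gauss_mul t n k
  have h0 : ∏ j ∈ Finset.range k, (1 - t ^ (n - j)) = 0 :=
    Finset.prod_eq_zero (Finset.mem_range.2 hk) (by simp [ht.pow_eq_one])
  rw [h0] at h
  refine (mul_eq_zero.1 h).resolve_right (Finset.prod_ne_zero_iff.2 fun j hj => ?_)
  have hj' := Finset.mem_range.1 hj
  rw [sub_ne_zero]
  exact (ht.pow_ne_one_of_pos_of_lt (by omega) (by omega)).symm

theorem gauss_succ_self (t : ℂ) (m k : ℕ) (h : m < k) : gauss t m k = 0 := by
  induction m generalizing k with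
  | zero => cases k with
    | zero => omega
    | succ k => rfl
  | succ m ih => cases k with
    | zero => omega
    | succ k => rw [gauss, ih k (by omega), ih (k + 1) (by omega)]; simp

section

variable {A : Type*} [Ring A] [Algebra ℂ A]

theorem y_mul_x_pow {x y : A} {t : ℂ} (h : y * x = t • (x * y)) (k : ℕ) :
    y * x ^ k = t ^ k • (x ^ k * y) := by
  induction k with
  | zero => simp
  | succ k ih =>
    rw [pow_succ, ← mul_assoc, ih, smul_mul_assoc, mul_assoc, h, mul_smul_comm, smul_smul,
      pow_succ, mul_assoc]

theorem add_pow_gauss {x y : A} {t : ℂ} (h : y * x = t • (x * y)) (m : ℕ) :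
    (x + y) ^ m = ∑ k ∈ Finset.range (m + 1), gauss t m k • (x ^ k * y ^ (m - k)) := by
  induction m with
  | zero => simp [gauss]
  | succ m ih =>
    have e1 : x * (x + y) ^ m
        = ∑ k ∈ Finset.range (m + 1), gauss t m k • (x ^ (k + 1) * y ^ (m - k)) := by
      rw [ih, Finset.mul_sum]
      refine Finset.sum_congr rfl fun k _ => ?_
      rw [mul_smul_comm, ← mul_assoc, pow_succ' x]
    have e2 : y * (x + y) ^ m
        = ∑ k ∈ Finset.range (m + 1), (t ^ k * gauss t m k) • (x ^ k * y ^ (m + 1 - k)) := by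
      rw [ih, Finset.mul_sum]
      refine Finset.sum_congr rfl fun k hk => ?_
      have hk' := Finset.mem_range.1 hk
      rw [mul_smul_comm, ← mul_assoc, y_mul_x_pow h, smul_mul_assoc, smul_smul, mul_assoc,
        ← pow_succ' y, mul_comm (gauss t m k)]
      congr 4
      omega
    have e3 : y * (x + y) ^ m
        = y ^ (m + 1) + ∑ k ∈ Finset.range (m + 1),
            (t ^ (k + 1) * gauss t m (k + 1)) • (x ^ (k + 1) * y ^ (m - k)) := by
      rw [e2, Finset.sum_range_succ' _ m, Finset.sum_range_succ _ m,
        gauss_succ_self t m (m + 1) (by omega), add_comm]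
      simp [gauss]
    rw [pow_succ', add_mul, e1, e3, Finset.sum_range_succ' _ (m + 1)]
    simp only [gauss, add_smul, Finset.sum_add_distrib, Nat.add_sub_add_right]
    simp only [pow_zero, one_smul, one_mul, Nat.sub_zero]
    abel

theorem add_pow_eq_zero {x y : A} {t : ℂ} {n : ℕ} (ht : IsPrimitiveRoot t n)
    (h : y * x = t • (x * y)) (hx : x ^ n = 0) (hy : y ^ n = 0) : (x + y) ^ n = 0 := by
  rw [add_pow_gauss h]
  refine Finset.sum_eq_zero fun k hk => ?_
  have hk' := Finset.mem_range.1 hk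
  rcases Nat.eq_zero_or_pos k with rfl | h0
  · simp [hy]
  · rcases Nat.lt_or_ge k n with h1 | h1
    · rw [gauss_eq_zero ht h0 h1, zero_smul]
    · obtain rfl : k = n := by omega
      simp [hx]

theorem mul_pow_eq_zero {x y : A} {t : ℂ} {n : ℕ}
    (h : y * x = t • (x * y)) (hx : x ^ n = 0) : (x * y) ^ n = 0 := by
  have key : ∀ m : ℕ, ∃ c : ℂ, (x * y) ^ m = c • (x ^ m * y ^ m) := by
    intro m
    induction m with
    | zero => exact ⟨1, by simp⟩
    | succ m ih =>
      obtain ⟨c, hc⟩ := ih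
      refine ⟨c * t ^ m, ?_⟩
      rw [pow_succ', hc, mul_smul_comm, mul_assoc x y, ← mul_assoc y, y_mul_x_pow h,
        smul_mul_assoc, mul_smul_comm, smul_smul, mul_assoc, ← pow_succ' y, ← mul_assoc x,
        ← pow_succ' x]
  obtain ⟨c, hc⟩ := key n
  rw [hc, hx, zero_mul, smul_zero]

end

/-! ### The Hopf algebra structure -/

section

variable {A : Type*} [Ring A] [Algebra ℂ A]

theorem conj_left {k k' x : A} {s : ℂ} (h : k' * k = 1) (hx : k * x * k' = s • x) :
    k * x = s • (x * k) := by
  rw [← smul_mul_assoc, ← hx, mul_assoc, h, mul_one]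

theorem conj_right {k k' x : A} {s : ℂ} (h : k' * k = 1) (hx : k * x * k' = s • x) :
    x * k' = s • (k' * x) := by
  rw [← mul_smul_comm, ← hx, mul_assoc k, ← mul_assoc k', h, one_mul]

end

theorem q_ne_zero (r : ℕ) : q r ≠ 0 := Complex.exp_ne_zero _

theorem r₁_pos (r : ℕ) [h : Fact (2 < r)] : 0 < r₁ r :=
  Nat.div_pos (Nat.gcd_le_left _ (by have := h.out; omega)) (Nat.gcd_pos_of_pos_right _ two_pos)

theorem q_sq_primitive (r : ℕ) [h : Fact (2 < r)] :
    IsPrimitiveRoot (q r ^ (2 : ℤ)) (r₁ r) := by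
  have hr := h.out
  have hq : IsPrimitiveRoot (q r) r := Complex.isPrimitiveRoot_exp r (by omega)
  rw [show q r ^ (2 : ℤ) = q r ^ 2 from zpow_natCast (q r) 2]
  unfold r₁
  rcases Nat.even_or_odd' r with ⟨m, hm | hm⟩
  · have : Nat.gcd r 2 = 2 := Nat.gcd_eq_right (by omega)
    rw [this]
    exact hq.pow (by omega) (by omega)
  · have h2 : Nat.Coprime 2 r := by
      rw [Nat.coprime_two_left]; exact ⟨m, hm⟩
    have : Nat.gcd r 2 = 1 := h2.symm
    rw [this, Nat.div_one]
    exact hq.pow_of_coprime 2 h2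

theorem K_mul_E (r : ℕ) : gen r Gen.K * gen r Gen.E = q r ^ (2 : ℤ) • (gen r Gen.E * gen r Gen.K) :=
  conj_left (gen_Kinv_K r) (gen_K_E r)

theorem E_mul_Kinv (r : ℕ) :
    gen r Gen.E * gen r Gen.Kinv = q r ^ (2 : ℤ) • (gen r Gen.Kinv * gen r Gen.E) :=
  conj_right (gen_Kinv_K r) (gen_K_E r)

theorem K_mul_F (r : ℕ) :
    gen r Gen.K * gen r Gen.F = q r ^ (-2 : ℤ) • (gen r Gen.F * gen r Gen.K) :=
  conj_left (gen_Kinv_K r) (gen_K_F r)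

theorem Kinv_mul_F (r : ℕ) :
    gen r Gen.Kinv * gen r Gen.F = q r ^ (2 : ℤ) • (gen r Gen.F * gen r Gen.Kinv) := by
  rw [conj_right (gen_Kinv_K r) (gen_K_F r), smul_smul, ← zpow_add₀ (q_ne_zero r)]
  simp

theorem E_mul_F (r : ℕ) :
    gen r Gen.E * gen r Gen.F = gen r Gen.F * gen r Gen.E
      + (q r - (q r)⁻¹)⁻¹ • (gen r Gen.K - gen r Gen.Kinv) := by
  rw [← gen_E_F]; abel

/-- The coproduct: `Δ(K) = K ⊗ K`, `Δ(E) = E ⊗ K + 1 ⊗ E`, `Δ(F) = F ⊗ 1 + K⁻¹ ⊗ F`. -/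
def comulHom (r : ℕ) [Fact (2 < r)] :
    SmallQuantumSl2 r →ₐ[ℂ] SmallQuantumSl2 r ⊗[ℂ] SmallQuantumSl2 r :=
  lift r (gen r Gen.K ⊗ₜ gen r Gen.K) (gen r Gen.Kinv ⊗ₜ gen r Gen.Kinv)
    (gen r Gen.E ⊗ₜ gen r Gen.K + 1 ⊗ₜ gen r Gen.E)
    (gen r Gen.F ⊗ₜ 1 + gen r Gen.Kinv ⊗ₜ gen r Gen.F)
    (by simp [gen_K_Kinv, Algebra.TensorProduct.one_def])
    (by simp [gen_Kinv_K, Algebra.TensorProduct.one_def])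
    (by
      simp only [mul_add, add_mul, Algebra.TensorProduct.tmul_mul_tmul, gen_K_E, mul_one,
        gen_K_Kinv, smul_add]
      rw [mul_assoc (gen r Gen.K) (gen r Gen.K), gen_K_Kinv, mul_one,
        TensorProduct.smul_tmul', TensorProduct.tmul_smul])
    (by
      simp only [mul_add, add_mul, Algebra.TensorProduct.tmul_mul_tmul, gen_K_F, mul_one,
        gen_K_Kinv, one_mul, smul_add]
      rw [TensorProduct.smul_tmul', TensorProduct.tmul_smul])
    (by
      simp only [mul_add, add_mul, Algebra.TensorProduct.tmul_mul_tmul, mul_one, one_mul]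
      have h : (gen r Gen.E * gen r Gen.Kinv) ⊗ₜ[ℂ] (gen r Gen.K * gen r Gen.F)
          = (gen r Gen.Kinv * gen r Gen.E) ⊗ₜ[ℂ] (gen r Gen.F * gen r Gen.K) := by
        rw [E_mul_Kinv, K_mul_F, TensorProduct.tmul_smul, ← TensorProduct.smul_tmul', smul_smul,
          ← zpow_add₀ (q_ne_zero r)]
        simp
      rw [h, E_mul_F]
      simp only [TensorProduct.add_tmul, TensorProduct.tmul_add, TensorProduct.tmul_smul,
        ← TensorProduct.smul_tmul', TensorProduct.tmul_sub, TensorProduct.sub_tmul, smul_sub]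
      abel)
    (by
      rw [Algebra.TensorProduct.tmul_pow, gen_K_pow, Algebra.TensorProduct.one_def])
    (by
      rw [add_comm]
      refine add_pow_eq_zero (q_sq_primitive r) ?_ ?_ ?_
      · simp only [Algebra.TensorProduct.tmul_mul_tmul, mul_one, one_mul, K_mul_E,
          TensorProduct.tmul_smul]
      · rw [Algebra.TensorProduct.tmul_pow, gen_E_pow, TensorProduct.tmul_zero]
      · rw [Algebra.TensorProduct.tmul_pow, gen_E_pow, TensorProduct.zero_tmul])
    (by
      refine add_pow_eq_zero (q_sq_primitive r) ?_ ?_ ?_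
      · simp only [Algebra.TensorProduct.tmul_mul_tmul, mul_one, one_mul, Kinv_mul_F,
          TensorProduct.smul_tmul']
      · rw [Algebra.TensorProduct.tmul_pow, gen_F_pow, TensorProduct.zero_tmul]
      · rw [Algebra.TensorProduct.tmul_pow, gen_F_pow, TensorProduct.tmul_zero])

/-- The counit: `ε(K) = 1`, `ε(E) = ε(F) = 0`. -/
def counitHom (r : ℕ) [Fact (2 < r)] : SmallQuantumSl2 r →ₐ[ℂ] ℂ :=
  lift r 1 1 0 0 (by simp) (by simp) (by simp) (by simp) (by simp) (by simp)
    (zero_pow (r₁_pos r).ne') (zero_pow (r₁_pos r).ne')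

/-- The antipode, as an algebra map to the opposite algebra:
`S(K) = K⁻¹`, `S(E) = -E K⁻¹`, `S(F) = -K F`. -/
def antipodeHom (r : ℕ) : SmallQuantumSl2 r →ₐ[ℂ] (SmallQuantumSl2 r)ᵐᵒᵖ :=
  lift r (MulOpposite.op (gen r Gen.Kinv)) (MulOpposite.op (gen r Gen.K))
    (MulOpposite.op (-(gen r Gen.E * gen r Gen.Kinv)))
    (MulOpposite.op (-(gen r Gen.K * gen r Gen.F)))
    (by rw [← MulOpposite.op_mul, gen_K_Kinv, MulOpposite.op_one])
    (by rw [← MulOpposite.op_mul, gen_Kinv_K, MulOpposite.op_one])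
    (by
      rw [← MulOpposite.op_mul, ← MulOpposite.op_mul, ← MulOpposite.op_smul]
      congr 1
      rw [neg_mul, mul_neg, ← mul_assoc, ← mul_assoc, gen_K_E, smul_mul_assoc, smul_neg])
    (by
      rw [← MulOpposite.op_mul, ← MulOpposite.op_mul, ← MulOpposite.op_smul]
      congr 1
      rw [neg_mul, mul_neg, mul_assoc (gen r Gen.K) (gen r Gen.F),
        ← mul_assoc (gen r Gen.K) (gen r Gen.F), gen_K_F, mul_smul_comm, smul_neg])
    (by
      rw [← MulOpposite.op_mul, ← MulOpposite.op_mul, ← MulOpposite.op_sub,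
        ← MulOpposite.op_sub, ← MulOpposite.op_smul]
      congr 1
      have h1 : gen r Gen.K * gen r Gen.F * (gen r Gen.E * gen r Gen.Kinv)
          = gen r Gen.F * gen r Gen.E := by
        rw [K_mul_F, E_mul_Kinv, smul_mul_smul_comm, ← zpow_add₀ (q_ne_zero r), mul_assoc,
          ← mul_assoc (gen r Gen.K), gen_K_Kinv]
        simp
      have h2 : gen r Gen.E * gen r Gen.Kinv * (gen r Gen.K * gen r Gen.F)
          = gen r Gen.E * gen r Gen.F := by
        rw [mul_assoc, ← mul_assoc (gen r Gen.Kinv), gen_Kinv_K, one_mul]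
      rw [neg_mul_neg, neg_mul_neg, h1, h2, E_mul_F, ← neg_sub (gen r Gen.K), smul_neg]
      abel)
    (by
      have h : gen r Gen.Kinv ^ r₁ r = 1 := by
        have h1 : (K r) ^ r₁ r = 1 := Units.ext (by simpa [K] using gen_K_pow r)
        have h2 : ((K r)⁻¹) ^ r₁ r = 1 := by rw [inv_pow, h1, inv_one]
        simpa [K] using congrArg Units.val h2
      rw [← MulOpposite.op_pow, h, MulOpposite.op_one])
    (by
      have h : gen r Gen.Kinv * gen r Gen.E
          = q r ^ (-2 : ℤ) • (gen r Gen.E * gen r Gen.Kinv) := by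
        rw [E_mul_Kinv, smul_smul, ← zpow_add₀ (q_ne_zero r)]
        simp
      rw [← MulOpposite.op_pow, neg_pow, mul_pow_eq_zero h (gen_E_pow r), mul_zero,
        MulOpposite.op_zero])
    (by
      have h : gen r Gen.K * gen r Gen.F = q r ^ (-2 : ℤ) • (gen r Gen.F * gen r Gen.K) :=
        K_mul_F r
      rw [← MulOpposite.op_pow, neg_pow, h, smul_pow, mul_pow_eq_zero h (gen_F_pow r), smul_zero,
        mul_zero, MulOpposite.op_zero])

theorem comulHom_gen (r : ℕ) [Fact (2 < r)] :
    comulHom r (gen r Gen.K) = gen r Gen.K ⊗ₜ gen r Gen.K ∧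
    comulHom r (gen r Gen.Kinv) = gen r Gen.Kinv ⊗ₜ gen r Gen.Kinv ∧
    comulHom r (gen r Gen.E) = gen r Gen.E ⊗ₜ gen r Gen.K + 1 ⊗ₜ gen r Gen.E ∧
    comulHom r (gen r Gen.F) = gen r Gen.F ⊗ₜ 1 + gen r Gen.Kinv ⊗ₜ gen r Gen.F :=
  lift_gen ..

theorem counitHom_gen (r : ℕ) [Fact (2 < r)] :
    counitHom r (gen r Gen.K) = 1 ∧ counitHom r (gen r Gen.Kinv) = 1 ∧
    counitHom r (gen r Gen.E) = 0 ∧ counitHom r (gen r Gen.F) = 0 :=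
  lift_gen ..

theorem antipodeHom_gen (r : ℕ) :
    antipodeHom r (gen r Gen.K) = MulOpposite.op (gen r Gen.Kinv) ∧
    antipodeHom r (gen r Gen.Kinv) = MulOpposite.op (gen r Gen.K) ∧
    antipodeHom r (gen r Gen.E) = MulOpposite.op (-(gen r Gen.E * gen r Gen.Kinv)) ∧
    antipodeHom r (gen r Gen.F) = MulOpposite.op (-(gen r Gen.K * gen r Gen.F)) :=
  lift_gen ..

instance (r : ℕ) [Fact (2 < r)] : Bialgebra ℂ (SmallQuantumSl2 r) :=
  Bialgebra.ofAlgHom (comulHom r) (counitHom r)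
    (by
      obtain ⟨h1, h2, h3, h4⟩ := comulHom_gen r
      refine hom_ext fun x => ?_
      cases x <;>
        simp [h1, h2, h3, h4, TensorProduct.add_tmul, TensorProduct.tmul_add,
          Algebra.TensorProduct.one_def, add_assoc])
    (by
      obtain ⟨h1, h2, h3, h4⟩ := comulHom_gen r
      obtain ⟨c1, c2, c3, c4⟩ := counitHom_gen r
      refine hom_ext fun x => ?_
      cases x <;> simp [h1, h2, h3, h4, c1, c2, c3, c4])
    (by
      obtain ⟨h1, h2, h3, h4⟩ := comulHom_gen r
      obtain ⟨c1, c2, c3, c4⟩ := counitHom_gen r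
      refine hom_ext fun x => ?_
      cases x <;> simp [h1, h2, h3, h4, c1, c2, c3, c4])

/-- The antipode as a linear endomorphism. -/
def antipodeLin (r : ℕ) : SmallQuantumSl2 r →ₗ[ℂ] SmallQuantumSl2 r :=
  (MulOpposite.opLinearEquiv ℂ).symm.toLinearMap ∘ₗ (antipodeHom r).toLinearMap

theorem antipodeLin_mul (r : ℕ) (x y : SmallQuantumSl2 r) :
    antipodeLin r (x * y) = antipodeLin r y * antipodeLin r x := by
  simp [antipodeLin]

theorem antipodeLin_algebraMap (r : ℕ) (c : ℂ) :
    antipodeLin r (algebraMap ℂ _ c) = algebraMap ℂ _ c := by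
  simp [antipodeLin]

theorem antipodeLin_one (r : ℕ) : antipodeLin r 1 = 1 := by
  simp [antipodeLin]

theorem antipodeLin_gen (r : ℕ) :
    antipodeLin r (gen r Gen.K) = gen r Gen.Kinv ∧
    antipodeLin r (gen r Gen.Kinv) = gen r Gen.K ∧
    antipodeLin r (gen r Gen.E) = -(gen r Gen.E * gen r Gen.Kinv) ∧
    antipodeLin r (gen r Gen.F) = -(gen r Gen.K * gen r Gen.F) := by
  obtain ⟨h1, h2, h3, h4⟩ := antipodeHom_gen r
  simp [antipodeLin, h1, h2, h3, h4]

theorem antipode_left_mul (r : ℕ) (a b : SmallQuantumSl2 r ⊗[ℂ] SmallQuantumSl2 r) (c : ℂ)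
    (ha : LinearMap.mul' ℂ _ ((antipodeLin r).rTensor _ a) = algebraMap ℂ _ c) :
    LinearMap.mul' ℂ _ ((antipodeLin r).rTensor _ (a * b))
      = algebraMap ℂ _ c * LinearMap.mul' ℂ _ ((antipodeLin r).rTensor _ b) := by
  induction b with
  | zero => simp
  | add b b' hb hb' => simp only [mul_add, map_add, hb, hb']
  | tmul y z =>
    have : LinearMap.mul' ℂ _ ((antipodeLin r).rTensor _ (a * (y ⊗ₜ[ℂ] z)))
        = antipodeLin r y * LinearMap.mul' ℂ _ ((antipodeLin r).rTensor _ a) * z := by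
      clear ha
      induction a with
      | zero => simp
      | add a a' h h' => simp only [add_mul, mul_add, map_add, h, h']
      | tmul s t => simp [antipodeLin_mul, mul_assoc]
    rw [this, ha, ← Algebra.commutes, mul_assoc]
    simp

theorem antipode_right_mul (r : ℕ) (a b : SmallQuantumSl2 r ⊗[ℂ] SmallQuantumSl2 r) (c : ℂ)
    (hb : LinearMap.mul' ℂ _ ((antipodeLin r).lTensor _ b) = algebraMap ℂ _ c) :
    LinearMap.mul' ℂ _ ((antipodeLin r).lTensor _ (a * b))
      = LinearMap.mul' ℂ _ ((antipodeLin r).lTensor _ a) * algebraMap ℂ _ c := by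
  induction a with
  | zero => simp
  | add a a' h h' => simp only [add_mul, map_add, h, h']
  | tmul y z =>
    have : LinearMap.mul' ℂ _ ((antipodeLin r).lTensor _ ((y ⊗ₜ[ℂ] z) * b))
        = y * LinearMap.mul' ℂ _ ((antipodeLin r).lTensor _ b) * antipodeLin r z := by
      clear hb
      induction b with
      | zero => simp
      | add a a' h h' => simp only [add_mul, mul_add, map_add, h, h']
      | tmul s t => simp [antipodeLin_mul, mul_assoc]
    rw [this, hb, mul_assoc, Algebra.commutes, ← mul_assoc]
    simp

instance (r : ℕ) [Fact (2 < r)] : HopfAlgebra ℂ (SmallQuantumSl2 r) where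
  antipode := antipodeLin r
  mul_antipode_rTensor_comul := by
    refine LinearMap.ext fun x => ?_
    change LinearMap.mul' ℂ _ ((antipodeLin r).rTensor _ (comulHom r x))
      = algebraMap ℂ _ (counitHom r x)
    obtain ⟨h1, h2, h3, h4⟩ := comulHom_gen r
    obtain ⟨c1, c2, c3, c4⟩ := counitHom_gen r
    obtain ⟨s1, s2, s3, s4⟩ := antipodeLin_gen r
    induction x using SmallQuantum.induction with
    | hC c => simp [Algebra.TensorProduct.algebraMap_apply, antipodeLin_algebraMap]
    | hadd x y hx hy => simp only [map_add, hx, hy]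
    | hmul x y hx hy => rw [map_mul, antipode_left_mul r _ _ _ hx, hy, map_mul, map_mul]
    | hgen x =>
      cases x
      · simp [h1, c1, s1, gen_Kinv_K]
      · simp [h2, c2, s2, gen_K_Kinv]
      · simp [h3, c3, s3, antipodeLin_one, mul_assoc, gen_Kinv_K]
      · simp [h4, c4, s4, s2]
  mul_antipode_lTensor_comul := by
    refine LinearMap.ext fun x => ?_
    change LinearMap.mul' ℂ _ ((antipodeLin r).lTensor _ (comulHom r x))
      = algebraMap ℂ _ (counitHom r x)
    obtain ⟨h1, h2, h3, h4⟩ := comulHom_gen r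
    obtain ⟨c1, c2, c3, c4⟩ := counitHom_gen r
    obtain ⟨s1, s2, s3, s4⟩ := antipodeLin_gen r
    induction x using SmallQuantum.induction with
    | hC c => simp [Algebra.TensorProduct.algebraMap_apply, antipodeLin_one]
    | hadd x y hx hy => simp only [map_add, hx, hy]
    | hmul x y hx hy => rw [map_mul, antipode_right_mul r _ _ _ hy, hx, map_mul, map_mul]
    | hgen x =>
      cases x
      · simp [h1, c1, s1, gen_K_Kinv]
      · simp [h2, c2, s2, gen_Kinv_K]
      · simp [h3, c3, s3, s1]
      · simp [h4, c4, s4, antipodeLin_one, ← mul_assoc, gen_Kinv_K]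

/-! ### R-matrix, Drinfeld element and ribbon element -/

/-- The Drinfeld element `u = S(R''ᵢ) R'ᵢ` of `R = R'ᵢ ⊗ R''ᵢ` in a Hopf algebra. -/
def drinfeldElement {H : Type*} [Ring H] [HopfAlgebra ℂ H] (R : H ⊗[ℂ] H) : H :=
  LinearMap.mul' ℂ H ((HopfAlgebra.antipode ℂ).rTensor H (TensorProduct.comm ℂ H H R))

/-- The R-matrix of `u_q sl₂`. -/
def rMatrix (r : ℕ) : SmallQuantumSl2 r ⊗[ℂ] SmallQuantumSl2 r :=
  (1 / (r₁ r : ℂ)) •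
    ∑ a ∈ Finset.range (r₁ r), ∑ b ∈ Finset.range (r₁ r), ∑ c ∈ Finset.range (r₁ r),
      (brace r 1 ^ a / qFact r a * q r ^ (((a : ℤ) * (a - 1)) / 2 - 2 * b * c)) •
        (((K r ^ b : (SmallQuantumSl2 r)ˣ) * E r ^ a) ⊗ₜ[ℂ]
          ((K r ^ c : (SmallQuantumSl2 r)ˣ) * F r ^ a))

/-- The pivotal element `g = K` of `u_q sl₂`. -/
def pivotal (r : ℕ) : (SmallQuantumSl2 r)ˣ := K r

/-- The ribbon element `v₊` of `u_q sl₂`: with `u` the Drinfeld element of the R-matrix, it is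
determined by the compatibility `g = u v₊⁻¹` with the pivotal element, that is, `v₊ = g⁻¹ u`. -/
def ribbonElement (r : ℕ) [Fact (2 < r)] : SmallQuantumSl2 r :=
  ((pivotal r)⁻¹ : (SmallQuantumSl2 r)ˣ) * drinfeldElement (rMatrix r)

end SmallQuantum

end

/-!
The eigenvalues of `K` are the powers of `q ^ 2`, so `K` has spectral idempotents `e_c`, and the
double sum over powers of `K` in the R-matrix collapses to a Gaussian element
`γ_n = ∑ q ^ (2 n c²) e_c`. With explicit scalars `c_a` this gives
`u = ∑ c_a F ^ a E ^ a K ^ (-a) γ_{-1}`, and `v₊` has the same shape. An element of this shape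
commutes with `F` because the terms of its commutator telescope. In the product of `v₊` and the
candidate for `v₋` the powers of `F` can then be moved across and the Gaussian elements cancel; what
remains is an alternating sum of `q`-binomial coefficients, which vanishes except in degree zero.
Completing the square expands `γ_{±1}` in powers of `K`, with a quadratic Gauss sum as overall
constant. Its value comes from the Landsberg–Schaar reciprocity law, which compares the two
asymptotics of a theta series at a rational point of the imaginary axis.
-/

/-! ### Quadratic Gauss sums -/

namespace QuadGaussSum

open Complex Filter Topology

/-- The theta series `∑ exp(-π s n²)`, `n ∈ ℤ`, in the variable `s = -i τ` of the right half-plane;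
its behaviour at the rational points of the imaginary axis is governed by quadratic Gauss sums. -/
noncomputable def thetaSeries (s : ℂ) : ℂ := ∑' n : ℤ, cexp (-Real.pi * s * n ^ 2)

/-- The quadratic Gauss sum `∑ exp(π i m n² / p)`, `0 ≤ n < p`, with `π i` rather than `2 π i` in
the exponent; it depends only on `n` modulo `p` when `m * p` is even. -/
noncomputable def quadGaussSum (m : ℤ) (p : ℕ) : ℂ :=
  ∑ n ∈ Finset.range p, cexp (Real.pi * I * m * n ^ 2 / p)

theorem ofReal_mul_cpow {x : ℝ} (hx : 0 < x) {z : ℂ} (hz : z ≠ 0) (s : ℂ) :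
    ((x : ℂ) * z) ^ s = (x : ℂ) ^ s * z ^ s := by
  have hx' : (x : ℂ) ≠ 0 := ofReal_ne_zero.2 hx.ne'
  rw [cpow_def_of_ne_zero (mul_ne_zero hx' hz), cpow_def_of_ne_zero hx', cpow_def_of_ne_zero hz,
    log_ofReal_mul hx hz, ← Complex.exp_add, ofReal_log hx.le, add_mul]

theorem ofReal_cpow_half {x : ℝ} (hx : 0 ≤ x) : (x : ℂ) ^ (1 / 2 : ℂ) = √x := by
  rw [Real.sqrt_eq_rpow, ofReal_cpow hx]
  push_cast
  rfl

theorem cpow_half_ne_zero {z : ℂ} (hz : z ≠ 0) : z ^ (1 / 2 : ℂ) ≠ 0 := by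
  rw [Ne, cpow_eq_zero_iff]
  tauto

theorem ofReal_sqrt_sq {x : ℝ} (hx : 0 ≤ x) : (√x : ℂ) ^ 2 = x := by
  rw [← ofReal_pow, Real.sq_sqrt hx]

theorem summable_exp_neg_mul_sq {s : ℂ} (hs : 0 < s.re) :
    Summable fun n : ℤ => cexp (-Real.pi * s * n ^ 2) := by
  have h := (summable_jacobiTheta₂_term_iff 0 (I * s)).2 (by simpa using hs)
  refine h.congr fun n => ?_
  rw [jacobiTheta₂_term]
  congr 1
  linear_combination (Real.pi * s * n ^ 2 : ℂ) * I_sq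

theorem norm_exp_neg_mul_sq_add (s : ℂ) (x : ℝ) (n : ℤ) :
    ‖cexp (-Real.pi * s * n ^ 2 + 2 * Real.pi * I * n * x)‖ =
      Real.exp (-Real.pi * s.re * n ^ 2) := by
  have hphase : (2 * Real.pi * I * n * x : ℂ) = ((2 * Real.pi * n * x : ℝ) : ℂ) * I := by
    push_cast; ring
  have hmodulus : (-Real.pi * s * n ^ 2 : ℂ) = ((-Real.pi * n ^ 2 : ℝ) : ℂ) * s := by
    push_cast; ring
  rw [Complex.exp_add, norm_mul, hphase, norm_exp_ofReal_mul_I, mul_one, norm_exp,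
    hmodulus, re_ofReal_mul]
  congr 1
  ring

theorem tendsto_tsum_exp_neg_mul_sq_add {ι : Type*} {l : Filter ι} {s : ι → ℂ}
    (hs : Tendsto (fun i => (s i).re) l atTop) (x : ℝ) :
    Tendsto (fun i => ∑' n : ℤ, cexp (-Real.pi * s i * n ^ 2 + 2 * Real.pi * I * n * x))
      l (𝓝 1) := by
  have hbound : Summable fun n : ℤ => Real.exp (-Real.pi * n ^ 2) :=
    (summable_exp_neg_mul_sq (s := 1) (by simp)).norm.congr fun n => by
      simpa using norm_exp_neg_mul_sq_add 1 0 n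
  rw [← tsum_ite_eq (0 : ℤ) fun _ => (1 : ℂ)]
  refine tendsto_tsum_of_dominated_convergence hbound (fun n => ?_) ?_
  · split_ifs with hn
    · simpa [hn] using tendsto_const_nhds
    · rw [tendsto_zero_iff_norm_tendsto_zero]
      simp only [norm_exp_neg_mul_sq_add]
      have hneg : -(Real.pi * (n : ℝ) ^ 2) < 0 := neg_neg_of_pos (by positivity)
      refine Real.tendsto_exp_atBot.comp ((hs.const_mul_atTop_of_neg hneg).congr fun i => ?_)
      ring
  · filter_upwards [hs.eventually_ge_atTop 1] with i hi n
    rw [norm_exp_neg_mul_sq_add]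
    have : 0 ≤ Real.pi * (n : ℝ) ^ 2 := by positivity
    exact Real.exp_le_exp.2 (by nlinarith)

theorem cpow_half_mul_tsum_exp_progression {s : ℂ} (hs : 0 < s.re) {p : ℕ} (hp : 0 < p) (j : ℕ) :
    s ^ (1 / 2 : ℂ) * ∑' k : ℤ, cexp (-Real.pi * s * (k * p + j) ^ 2) =
      1 / p * ∑' n : ℤ, cexp (-Real.pi * (1 / (p ^ 2 * s)) * n ^ 2
        + 2 * Real.pi * I * n * ((j / p : ℝ) : ℝ)) := by
  have hs0 : s ≠ 0 := by rintro rfl; simp at hs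
  have hp0 : (p : ℂ) ≠ 0 := by exact_mod_cast hp.ne'
  have hre : 0 < (((p ^ 2 : ℝ) : ℂ) * s).re := by
    rw [re_ofReal_mul]; positivity
  have poisson := Complex.tsum_exp_neg_quadratic hre (-(s * p * j))
  have hleft : ∀ k : ℤ, cexp (-Real.pi * s * (k * p + j) ^ 2) =
      cexp (-Real.pi * s * j ^ 2) * cexp (-Real.pi * (((p ^ 2 : ℝ) : ℂ) * s) * k ^ 2
        + 2 * Real.pi * (-(s * p * j)) * k) := by
    intro k
    rw [← Complex.exp_add]
    push_cast
    ring_nf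
  have hright : ∀ n : ℤ, cexp (-Real.pi * s * j ^ 2) *
      cexp (-Real.pi / (((p ^ 2 : ℝ) : ℂ) * s) * (n + I * (-(s * p * j))) ^ 2) =
      cexp (-Real.pi * (1 / (p ^ 2 * s)) * n ^ 2 + 2 * Real.pi * I * n * ((j / p : ℝ) : ℝ)) := by
    intro n
    rw [← Complex.exp_add]
    congr 1
    push_cast
    field_simp
    linear_combination (-(s ^ 2 * p ^ 2 * j ^ 2 : ℂ)) * I_sq
  have hsqrt := cpow_half_ne_zero hs0
  simp_rw [hleft, tsum_mul_left, poisson, ofReal_mul_cpow (x := (p : ℝ) ^ 2) (by positivity) hs0,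
    ofReal_cpow_half (sq_nonneg (p : ℝ)), Real.sqrt_sq p.cast_nonneg, ← hright, tsum_mul_left]
  push_cast
  field_simp

theorem tsum_int_eq_sum_tsum_residues {R : Type*} [AddCommGroup R] [UniformSpace R]
    [IsUniformAddGroup R] [CompleteSpace R] [T0Space R] {f : ℤ → R} (hf : Summable f) (p : ℕ)
    [NeZero p] : ∑' n : ℤ, f n = ∑ j ∈ Finset.range p, ∑' k : ℤ, f (k * p + j) := by
  rw [← (Int.divModEquiv p).symm.tsum_eq, ← (Equiv.prodComm _ _).tsum_eq, Summable.tsum_prod,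
    tsum_fintype, Finset.sum_range fun j => ∑' k : ℤ, f (k * p + j)]
  · simp only [Equiv.prodComm_apply, Prod.swap_prod_mk, Int.divModEquiv, Equiv.coe_fn_symm_mk]
  · exact (Equiv.summable_iff _).2 ((Equiv.summable_iff _).2 hf)

theorem exp_quad_add_mul {m : ℤ} {p : ℕ} (hp : 0 < p) (hmp : Even (m * p)) (k : ℤ) (j : ℕ) :
    cexp (Real.pi * I * m * (k * p + j) ^ 2 / p) = cexp (Real.pi * I * m * j ^ 2 / p) := by
  obtain ⟨c, hc⟩ := hmp
  have hc' : (m * p : ℂ) = c + c := by exact_mod_cast hc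
  have hp0 : (p : ℂ) ≠ 0 := by exact_mod_cast hp.ne'
  rw [Complex.exp_eq_exp_iff_exists_int]
  refine ⟨c * k ^ 2 + m * k * j, ?_⟩
  push_cast
  field_simp
  linear_combination k ^ 2 * p * hc'

theorem thetaSeries_sub_mul_I {s : ℂ} (hs : 0 < s.re) {m : ℤ} {p : ℕ} (hp : 0 < p)
    (hmp : Even (m * p)) :
    thetaSeries (s - I * (m / p)) = ∑ j ∈ Finset.range p, cexp (Real.pi * I * m * j ^ 2 / p) *
      ∑' k : ℤ, cexp (-Real.pi * s * (k * p + j) ^ 2) := by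
  have : NeZero p := ⟨hp.ne'⟩
  have hre : (s - I * (m / p)).re = s.re := by
    rw [show (m / p : ℂ) = ((m / p : ℝ) : ℂ) by push_cast; rfl]
    simp
  rw [thetaSeries, tsum_int_eq_sum_tsum_residues (summable_exp_neg_mul_sq (hre ▸ hs)) p]
  refine Finset.sum_congr rfl fun j _ => ?_
  rw [← tsum_mul_left]
  refine tsum_congr fun k => ?_
  rw [← exp_quad_add_mul hp hmp k j, ← Complex.exp_add]
  push_cast
  ring_nf

theorem tendsto_cpow_half_mul_thetaSeries {ι : Type*} {l : Filter ι} {s : ι → ℂ}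
    (hs : ∀ᶠ i in l, 0 < (s i).re) (hs' : Tendsto (fun i => (1 / s i).re) l atTop)
    {m : ℤ} {p : ℕ} (hp : 0 < p) (hmp : Even (m * p)) :
    Tendsto (fun i => s i ^ (1 / 2 : ℂ) * thetaSeries (s i - I * (m / p))) l
      (𝓝 (quadGaussSum m p / p)) := by
  have hterm (j : ℕ) : Tendsto (fun i => ∑' n : ℤ, cexp (-Real.pi * (1 / (p ^ 2 * s i)) * n ^ 2
      + 2 * Real.pi * I * n * ((j / p : ℝ) : ℝ))) l (𝓝 1) := by
    have hc : (0 : ℝ) < 1 / p ^ 2 := by positivity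
    refine tendsto_tsum_exp_neg_mul_sq_add ((hs'.const_mul_atTop hc).congr fun i => ?_) _
    rw [← re_ofReal_mul]
    push_cast
    rw [one_div_mul_one_div]
  have hsum := tendsto_finsetSum (Finset.range p) fun j _ =>
    ((hterm j).const_mul (1 / p : ℂ)).const_mul (cexp (Real.pi * I * m * j ^ 2 / p))
  rw [← Finset.sum_mul, mul_one, mul_one_div] at hsum
  refine hsum.congr' ?_
  filter_upwards [hs] with i hi
  rw [thetaSeries_sub_mul_I hi hp hmp, Finset.mul_sum]
  refine Finset.sum_congr rfl fun j _ => ?_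
  rw [← cpow_half_mul_tsum_exp_progression hi hp]
  ring

theorem cpow_half_mul_thetaSeries {z : ℂ} (hz : 0 < z.re) :
    z ^ (1 / 2 : ℂ) * thetaSeries z = thetaSeries (1 / z) := by
  have hz0 : z ≠ 0 := by rintro rfl; simp at hz
  simp only [thetaSeries, Complex.tsum_exp_neg_mul_int_sq hz, one_div, ← div_eq_mul_inv]
  rw [mul_inv_cancel_left₀ (by simpa using cpow_half_ne_zero hz0)]

theorem neg_I_mul_cpow_half {c : ℝ} (hc : 0 < c) :
    (-(I * c)) ^ (1 / 2 : ℂ) = √c * cexp (-(Real.pi / 4 * I)) := by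
  rw [show -(I * c) = c * (-I) by ring, ofReal_mul_cpow hc (by simp), ofReal_cpow_half hc.le,
    cpow_def_of_ne_zero (x := -I) (by simp), log_neg_I]
  ring_nf

theorem sq_add_mul_I_ne_zero {c : ℝ} (hc : c ≠ 0) (t : ℝ) : (c ^ 2 + I * c * t : ℂ) ≠ 0 :=
  fun h => hc (by simpa [← ofReal_pow] using congrArg re h)

theorem one_div_sub_mul_I {c : ℝ} (hc : c ≠ 0) {t : ℝ} (ht : t ≠ 0) :
    1 / (t - I * c : ℂ) = t * (1 / (c ^ 2 + I * c * t)) + I * (1 / c) := by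
  have hz : (t - I * c : ℂ) ≠ 0 := fun h => ht (by simpa using congrArg re h)
  have hw := sq_add_mul_I_ne_zero hc t
  have hc' : (c : ℂ) ≠ 0 := ofReal_ne_zero.2 hc
  rw [← sub_eq_iff_eq_add, mul_one_div, mul_one_div, div_sub_div _ _ hz hc',
    div_eq_div_iff (mul_ne_zero hz hc') hw]
  linear_combination (c ^ 3 + I * c ^ 2 * t - c * t ^ 2) * I_sq

theorem tendsto_cpow_half_mul_cpow_half {c : ℝ} (hc : 0 < c) :
    Tendsto (fun t : ℝ => (1 / (c ^ 2 + I * c * t : ℂ)) ^ (1 / 2 : ℂ) *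
      (t - I * c : ℂ) ^ (1 / 2 : ℂ)) (𝓝[>] 0) (𝓝 (cexp (-(Real.pi / 4 * I)) / √c)) := by
  have hlim : Tendsto (fun t : ℝ => (t : ℂ)) (𝓝[>] 0) (𝓝 0) :=
    (continuous_ofReal.tendsto' 0 0 ofReal_zero).mono_left nhdsWithin_le_nhds
  have hw : Tendsto (fun t : ℝ => 1 / (c ^ 2 + I * c * t : ℂ)) (𝓝[>] 0)
      (𝓝 (((c ^ 2)⁻¹ : ℝ) : ℂ)) := by
    have := (hlim.const_mul (I * c)).const_add (c ^ 2 : ℂ)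
    simp_rw [one_div]
    simpa using this.inv₀ (by simpa using hc.ne')
  have hz : Tendsto (fun t : ℝ => (t - I * c : ℂ)) (𝓝[>] 0) (𝓝 (-(I * c))) := by
    simpa using hlim.sub_const (I * c : ℂ)
  have h := (hw.cpow (tendsto_const_nhds (x := (1 / 2 : ℂ)))
    (.inl (by rw [ofReal_re]; positivity))).mul
    (hz.cpow (tendsto_const_nhds (x := (1 / 2 : ℂ))) (.inr (by simpa using hc.ne')))
  have hc' := ofReal_sqrt_sq hc.le
  have hsc : (√c : ℂ) ≠ 0 := ofReal_ne_zero.2 (Real.sqrt_pos.2 hc).ne'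
  rw [ofReal_cpow_half (by positivity), neg_I_mul_cpow_half hc, Real.sqrt_inv,
    Real.sqrt_sq hc.le, ofReal_inv] at h
  convert h using 2
  rw [← hc']
  field_simp

theorem cpow_half_mul_thetaSeries_inversion {c t : ℝ} (hc : 0 < c) (ht : 0 < t) :
    (t * (1 / (c ^ 2 + I * c * t : ℂ))) ^ (1 / 2 : ℂ) *
        thetaSeries (t * (1 / (c ^ 2 + I * c * t)) + I * (1 / c)) =
      (1 / (c ^ 2 + I * c * t : ℂ)) ^ (1 / 2 : ℂ) * (t - I * c : ℂ) ^ (1 / 2 : ℂ) *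
        ((t : ℂ) ^ (1 / 2 : ℂ) * thetaSeries (t - I * c)) := by
  rw [← one_div_sub_mul_I hc.ne' ht.ne', ← cpow_half_mul_thetaSeries (by simpa using ht),
    ofReal_mul_cpow ht (one_div_ne_zero (sq_add_mul_I_ne_zero hc.ne' t))]
  ring

theorem re_mul_one_div_pos {c t : ℝ} (hc : 0 < c) (ht : 0 < t) :
    0 < (t * (1 / (c ^ 2 + I * c * t : ℂ))).re := by
  have hre : (c ^ 2 + I * c * t : ℂ).re = c ^ 2 := by simp [← ofReal_pow]
  rw [re_ofReal_mul, one_div, inv_re, hre]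
  exact mul_pos ht (div_pos (pow_pos hc 2) (normSq_pos.2 (sq_add_mul_I_ne_zero hc.ne' t)))

theorem tendsto_re_one_div_mul {c : ℝ} (hc : 0 < c) :
    Tendsto (fun t : ℝ => (1 / (t * (1 / (c ^ 2 + I * c * t : ℂ)))).re) (𝓝[>] 0) atTop := by
  refine (tendsto_inv_nhdsGT_zero.const_mul_atTop (pow_pos hc 2)).congr fun t => ?_
  have hre : (c ^ 2 + I * c * t : ℂ).re = c ^ 2 := by simp [← ofReal_pow]
  rw [mul_one_div, one_div_div, div_ofReal_re, div_eq_mul_inv, hre]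

theorem quadGaussSum_reciprocity {m p : ℕ} (hm : 0 < m) (hp : 0 < p) (hmp : Even (m * p)) :
    quadGaussSum m p = √(p : ℝ) / √(m : ℝ) * cexp (Real.pi / 4 * I) * quadGaussSum (-p) m := by
  obtain ⟨c, hc⟩ : ∃ c : ℝ, c = m / p := ⟨_, rfl⟩
  have hc0 : 0 < c := by rw [hc]; positivity
  have hdirect := tendsto_cpow_half_mul_thetaSeries (l := 𝓝[>] 0) (s := fun t : ℝ => (t : ℂ))
    (eventually_mem_nhdsWithin.mono fun t ht => by simpa using ht)
    (by simpa [← ofReal_inv] using tendsto_inv_nhdsGT_zero) (m := m) hp (by exact_mod_cast hmp)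
  have hdual := tendsto_cpow_half_mul_thetaSeries (l := 𝓝[>] 0)
    (s := fun t : ℝ => t * (1 / (c ^ 2 + I * c * t : ℂ)))
    (eventually_mem_nhdsWithin.mono fun t ht => re_mul_one_div_pos hc0 ht)
    (tendsto_re_one_div_mul hc0) (m := -p) hm
    (by rw [neg_mul, even_neg, mul_comm]; exact_mod_cast hmp)
  have hlim := tendsto_nhds_unique (hdual.congr' (eventually_mem_nhdsWithin.mono fun t ht => ?_))
    ((tendsto_cpow_half_mul_cpow_half hc0).mul hdirect)
  swap
  · rw [show (((m : ℤ) : ℂ) / p : ℂ) = c by rw [hc]; push_cast; rfl,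
      show (((-p : ℤ) : ℂ) / m : ℂ) = -(1 / c) by rw [hc]; push_cast; rw [one_div_div, neg_div],
      mul_neg, sub_neg_eq_add, cpow_half_mul_thetaSeries_inversion hc0 ht]
  have hm' := ofReal_sqrt_sq m.cast_nonneg
  have hp' := ofReal_sqrt_sq p.cast_nonneg
  have hm0 : (√(m : ℝ) : ℂ) ≠ 0 := ofReal_ne_zero.2 (Real.sqrt_pos.2 (by positivity)).ne'
  have hp0 : (√(p : ℝ) : ℂ) ≠ 0 := ofReal_ne_zero.2 (Real.sqrt_pos.2 (by positivity)).ne'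
  rw [ofReal_natCast] at hm' hp'
  rw [hc, Real.sqrt_div m.cast_nonneg, ofReal_div, Complex.exp_neg, ← hm', ← hp'] at hlim
  field_simp at hlim ⊢
  linear_combination -hlim

theorem exp_pi_div_four_mul_I : cexp (Real.pi / 4 * I) = (1 + I) / √2 := by
  rw [Complex.exp_mul_I, show (Real.pi / 4 : ℂ) = ((Real.pi / 4 : ℝ) : ℂ) by push_cast; rfl,
    ← ofReal_cos, ← ofReal_sin, Real.cos_pi_div_four, Real.sin_pi_div_four]
  have hsqrt : (√2 : ℂ) ^ 2 = 2 := by simpa using ofReal_sqrt_sq (zero_le_two (α := ℝ))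
  have h0 : (√2 : ℂ) ≠ 0 := by rintro h0; simp [h0] at hsqrt
  push_cast
  field_simp
  linear_combination (1 + I) * hsqrt

theorem exp_neg_pi_mul_I_mul_div_two (n : ℕ) : cexp (-(Real.pi * I * n / 2)) = (-I) ^ n := by
  rw [show -(Real.pi * I * n / 2 : ℂ) = n * (-(Real.pi / 2 * I)) by ring, Complex.exp_nat_mul,
    Complex.exp_neg, Complex.exp_pi_div_two_mul_I, inv_I]

theorem quadGaussSum_neg (m : ℤ) (p : ℕ) :
    quadGaussSum (-m) p = starRingEnd ℂ (quadGaussSum m p) := by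
  rw [quadGaussSum, quadGaussSum, map_sum]
  refine Finset.sum_congr rfl fun n _ => ?_
  rw [← Complex.exp_conj]
  simp only [map_div₀, map_mul, map_pow, conj_I, conj_ofReal, map_intCast, map_natCast]
  push_cast
  ring_nf

theorem quadGaussSum_two {p : ℕ} (hp : 0 < p) :
    quadGaussSum 2 p = √(p : ℝ) * ((1 + I) / 2 * (1 + (-I) ^ p)) := by
  have hsum : quadGaussSum (-p) 2 = 1 + (-I) ^ p := by
    rw [← exp_neg_pi_mul_I_mul_div_two, quadGaussSum, Finset.sum_range_succ, Finset.sum_range_one]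
    push_cast
    ring_nf
    rw [Complex.exp_zero]
  have h2 : (√2 : ℂ) ^ 2 = 2 := by simpa using ofReal_sqrt_sq (zero_le_two (α := ℝ))
  have h0 : (√2 : ℂ) ≠ 0 := by rintro h0; simp [h0] at h2
  have h := quadGaussSum_reciprocity two_pos hp (even_two_mul p)
  rw [hsum, exp_pi_div_four_mul_I, Nat.cast_ofNat, Nat.cast_ofNat] at h
  rw [h]
  field_simp
  linear_combination (-(√(p : ℝ) : ℂ) * (1 + I) * (1 + (-I) ^ p)) * h2

theorem neg_I_pow_four : (-I) ^ 4 = 1 := by rw [(by decide : Even 4).neg_pow, I_pow_four]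

theorem quadGaussSum_two_of_four_dvd {p : ℕ} (hp : 0 < p) (h : 4 ∣ p) :
    quadGaussSum 2 p = √(p : ℝ) * (1 + I) := by
  obtain ⟨k, rfl⟩ := h
  rw [quadGaussSum_two hp, pow_mul, neg_I_pow_four, one_pow]
  ring

theorem jacobiSym_two_mul_neg_I_pow (j : ℕ) :
    (1 + I) / 2 * (1 + (-I) ^ (2 * j + 1)) = jacobiSym 2 (2 * j + 1) * (-I) ^ j := by
  have hI3 : (-I) ^ 3 = I := by linear_combination (-I) * I_sq
  have hI2 : (-I) ^ 2 = -1 := by linear_combination I_sq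
  rw [jacobiSym.at_two (odd_two_mul_add_one j), ZMod.χ₈_nat_mod_eight, pow_succ, pow_mul, hI2]
  obtain ⟨i, l, hl, rfl⟩ : ∃ i l, l < 4 ∧ j = 4 * i + l := ⟨j / 4, j % 4, by omega, by omega⟩
  rw [show (2 * (4 * i + l) + 1) % 8 = 2 * l + 1 by omega, pow_add, pow_add, pow_mul, pow_mul,
    neg_I_pow_four, (by decide : Even 4).neg_one_pow, one_pow, one_mul, one_mul]
  interval_cases l
  · rw [show ZMod.χ₈ (2 * 0 + 1 : ℕ) = 1 by decide]
    push_cast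
    linear_combination (-1 / 2) * I_sq
  · rw [show ZMod.χ₈ (2 * 1 + 1 : ℕ) = -1 by decide]
    push_cast
    linear_combination (1 / 2) * I_sq
  · rw [show ZMod.χ₈ (2 * 2 + 1 : ℕ) = -1 by decide, hI2]
    push_cast
    linear_combination (-1 / 2) * I_sq
  · rw [show ZMod.χ₈ (2 * 3 + 1 : ℕ) = 1 by decide, hI3]
    push_cast
    linear_combination (1 / 2) * I_sq

theorem neg_I_pow_eq_I_zpow (j : ℕ) : (-I) ^ j = I ^ (-(j : ℤ)) := by
  rw [zpow_neg, ← inv_zpow, inv_I, zpow_natCast]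

theorem quadGaussSum_two_of_odd {p : ℕ} (hp : Odd p) :
    quadGaussSum 2 p = √(p : ℝ) * (jacobiSym 2 p * I ^ (-(((p : ℤ) - 1) / 2))) := by
  rw [quadGaussSum_two hp.pos]
  obtain ⟨j, rfl⟩ := hp
  rw [jacobiSym_two_mul_neg_I_pow, neg_I_pow_eq_I_zpow,
    show (((2 * j + 1 : ℕ) : ℤ) - 1) / 2 = j by omega]

theorem quadGaussSum_neg_four_of_odd (j : ℕ) :
    quadGaussSum (-(2 * j + 1 : ℕ)) 4 = 2 * cexp (-(Real.pi / 4 * I)) * (-I) ^ j := by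
  have h1 : cexp (-(Real.pi * I * (2 * j + 1) / 4)) = cexp (-(Real.pi / 4 * I)) * (-I) ^ j := by
    rw [← exp_neg_pi_mul_I_mul_div_two, ← Complex.exp_add]
    ring_nf
  have h2 : cexp (-(Real.pi * I * (2 * j + 1))) = -1 := by
    rw [Complex.exp_neg, show Real.pi * I * (2 * j + 1) = (j : ℤ) * (2 * Real.pi * I) + Real.pi * I
      by push_cast; ring, Complex.exp_add, Complex.exp_int_mul_two_pi_mul_I, exp_pi_mul_I]
    norm_num
  have h3 : cexp (-(Real.pi * I * (2 * j + 1) * 9 / 4)) = cexp (-(Real.pi / 4 * I)) * (-I) ^ j := by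
    rw [← h1, Complex.exp_eq_exp_iff_exists_int]
    refine ⟨-(2 * j + 1), ?_⟩
    push_cast
    ring
  have hsum : quadGaussSum (-(2 * j + 1 : ℕ)) 4 = 1 + cexp (-(Real.pi * I * (2 * j + 1) / 4)) +
      cexp (-(Real.pi * I * (2 * j + 1))) + cexp (-(Real.pi * I * (2 * j + 1) * 9 / 4)) := by
    rw [quadGaussSum]
    simp only [Finset.sum_range_succ, Finset.sum_range_zero]
    push_cast
    ring_nf
    rw [Complex.exp_zero]
  rw [hsum, h1, h2, h3]
  ring

theorem quadGaussSum_four_of_odd {p : ℕ} (hp : Odd p) :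
    quadGaussSum 4 p = √(p : ℝ) * I ^ (-(((p : ℤ) - 1) / 2)) := by
  have hsqrt : √(4 : ℝ) = 2 := by rw [show (4 : ℝ) = 2 ^ 2 by norm_num, Real.sqrt_sq zero_le_two]
  have h := quadGaussSum_reciprocity four_pos hp.pos ((by decide : Even 4).mul_right p)
  obtain ⟨j, rfl⟩ := hp
  rw [quadGaussSum_neg_four_of_odd, neg_I_pow_eq_I_zpow, Complex.exp_neg, Nat.cast_ofNat,
    Nat.cast_ofNat, hsqrt] at h
  rw [h, show (((2 * j + 1 : ℕ) : ℤ) - 1) / 2 = j by omega]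
  push_cast
  field_simp

theorem quadGaussSum_units_mul_four {p : ℕ} (hp : Odd p) (ε : ℤˣ) :
    quadGaussSum (ε * 4) p = √(p : ℝ) * I ^ (-(ε * (((p : ℤ) - 1) / 2))) := by
  obtain rfl | rfl := Int.units_eq_one_or ε
  · simpa using quadGaussSum_four_of_odd hp
  · rw [Units.val_neg, Units.val_one, neg_one_mul, quadGaussSum_neg, quadGaussSum_four_of_odd hp,
      map_mul, conj_ofReal, map_zpow₀, conj_I, ← inv_I, inv_zpow', neg_neg, neg_one_mul, neg_neg]

theorem quadGaussSum_units_mul_two_of_odd {p : ℕ} (hp : Odd p) (ε : ℤˣ) :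
    quadGaussSum (ε * 2) p =
      √(p : ℝ) * (jacobiSym 2 p * I ^ (-(ε * (((p : ℤ) - 1) / 2)))) := by
  obtain rfl | rfl := Int.units_eq_one_or ε
  · simpa using quadGaussSum_two_of_odd hp
  · rw [Units.val_neg, Units.val_one, neg_one_mul, quadGaussSum_neg, quadGaussSum_two_of_odd hp,
      map_mul, map_mul, map_intCast, conj_ofReal, map_zpow₀, conj_I, ← inv_I, inv_zpow', neg_neg,
      neg_one_mul, neg_neg]

theorem quadGaussSum_units_mul_two_of_four_dvd {p : ℕ} (hp : 0 < p) (h : 4 ∣ p) (ε : ℤˣ) :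
    quadGaussSum (ε * 2) p = √(p : ℝ) * (1 + (ε : ℤ) * I) := by
  obtain rfl | rfl := Int.units_eq_one_or ε
  · simpa using quadGaussSum_two_of_four_dvd hp h
  · rw [Units.val_neg, Units.val_one, neg_one_mul, quadGaussSum_neg,
      quadGaussSum_two_of_four_dvd hp h]
    simp

theorem inv_natCast_mul_sqrt_mul (N : ℕ) (z : ℂ) : (N : ℂ)⁻¹ * (√(N : ℝ) * z) = z / √(N : ℝ) := by
  rcases N.eq_zero_or_pos with rfl | hN
  · simp
  have hsqrt : (√(N : ℝ) : ℂ) ≠ 0 := by simp [hN.ne']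
  rw [← ofReal_natCast, ← ofReal_sqrt_sq N.cast_nonneg]
  field_simp

end QuadGaussSum

noncomputable section

namespace SmallQuantum

open QuadGaussSum

/-! ### Spectral idempotents and Gaussian elements of a unit of finite order -/

section

variable {M : Type*} [AddCommMonoid M]

theorem sum_range_add_of_periodic {N : ℕ} {g : ℤ → M} (hg : Function.Periodic g N) (m : ℤ) :
    ∑ i ∈ Finset.range N, g (i + m) = ∑ i ∈ Finset.range N, g i := by
  have hstep (m : ℤ) :
      ∑ i ∈ Finset.range N, g (i + (m + 1)) = ∑ i ∈ Finset.range N, g (i + m) := by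
    obtain _ | n := N
    · rfl
    rw [Finset.sum_range_succ, Finset.sum_range_succ' (fun i : ℕ => g (i + m))]
    congr 1
    · refine Finset.sum_congr rfl fun i _ => ?_
      push_cast
      rw [add_assoc, add_comm m]
    · rw [Nat.cast_zero, ← hg (0 + m)]
      push_cast
      congr 1
      ring
  induction m with
  | zero => simp
  | succ m ih => rw [hstep, ih]
  | pred m ih => rw [← hstep, ← ih]; simp

theorem sum_range_two_mul (g : ℕ → M) (n : ℕ) :
    ∑ i ∈ Finset.range (2 * n), g i =
      ∑ i ∈ Finset.range n, g (2 * i) + ∑ i ∈ Finset.range n, g (2 * i + 1) := by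
  induction n with
  | zero => simp
  | succ n ih =>
    rw [mul_add_one, Finset.sum_range_succ, Finset.sum_range_succ, ih, Finset.sum_range_succ,
      Finset.sum_range_succ]
    abel

theorem sum_range_mul (g : ℕ → M) (t s : ℕ) :
    ∑ i ∈ Finset.range (t * s), g i =
      ∑ b ∈ Finset.range s, ∑ m ∈ Finset.range t, g (t * b + m) := by
  induction s with
  | zero => simp
  | succ s ih => rw [mul_add_one, Finset.sum_range_add, ih, Finset.sum_range_succ]

end

section

variable {𝕜 A : Type*} [Field 𝕜] [Ring A] [Algebra 𝕜 A] {ζ : 𝕜} {N : ℕ} {k : Aˣ}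

theorem units_zpow_mul_of_mul_eq_smul {x : A} {s : 𝕜} (hs : s ≠ 0) (h : k * x = s • (x * k))
    (m : ℤ) : ↑(k ^ m) * x = s ^ m • (x * ↑(k ^ m)) := by
  have hinv : ↑k⁻¹ * x = s⁻¹ • (x * ↑k⁻¹) := by
    rw [Units.inv_mul_eq_iff_eq_mul, mul_smul_comm, ← mul_assoc, h, smul_mul_assoc,
      inv_smul_smul₀ hs, Units.mul_inv_cancel_right]
  induction m with
  | zero => simp
  | succ m ih =>
    rw [zpow_add_one, Units.val_mul, mul_assoc, h, mul_smul_comm, ← mul_assoc, ih,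
      smul_mul_assoc, smul_smul, mul_assoc, zpow_add_one₀ hs, mul_comm s]
  | pred m ih =>
    rw [zpow_sub_one, Units.val_mul, mul_assoc, hinv, mul_smul_comm, ← mul_assoc, ih,
      smul_mul_assoc, smul_smul, mul_assoc, zpow_sub_one₀ hs, mul_comm s⁻¹]

theorem zpow_eq_zpow_of_modEq (hζ : IsPrimitiveRoot ζ N) {m n : ℤ} (h : m ≡ n [ZMOD N]) :
    ζ ^ m = ζ ^ n := by
  obtain rfl | hN := eq_or_ne N 0
  · rw [show m = n by simpa using h]
  obtain ⟨x, hx⟩ := h.symm.dvd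
  rw [eq_add_of_sub_eq hx, zpow_add₀ (hζ.ne_zero hN), zpow_mul, zpow_natCast, hζ.pow_eq_one,
    one_zpow, one_mul]

theorem units_zpow_add_of_pow_eq_one (hk : k ^ N = 1) (m : ℤ) : k ^ (m + N) = k ^ m := by
  rw [zpow_add, zpow_natCast, hk, mul_one]

theorem sum_zpow_mul_eq_zero (hζ : IsPrimitiveRoot ζ N) {n : ℤ} (hn : ¬(N : ℤ) ∣ n) :
    ∑ d ∈ Finset.range N, ζ ^ (n * d) = 0 := by
  have hne : ζ ^ n ≠ 1 := fun h => hn ((hζ.zpow_eq_one_iff_dvd n).1 h)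
  have hpow : (ζ ^ n) ^ N = 1 := by
    rw [← zpow_natCast, zpow_comm, zpow_natCast, hζ.pow_eq_one, one_zpow]
  have hgeom := geom_sum_mul (ζ ^ n) N
  rw [hpow, sub_self, mul_eq_zero] at hgeom
  simpa only [zpow_mul, zpow_natCast] using hgeom.resolve_right (sub_ne_zero.2 hne)

/-- The spectral projection of a unit `k` with `k ^ N = 1` onto its eigenspace for the eigenvalue
`ζ ^ c`, where `ζ` is a primitive `N`-th root of unity. -/
def spectralIdem (ζ : 𝕜) (N : ℕ) (k : Aˣ) (c : ℤ) : A :=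
  (N : 𝕜)⁻¹ • ∑ d ∈ Finset.range N, ζ ^ (-(c * d)) • ((k ^ (d : ℤ) : Aˣ) : A)

/-- The element acting by `ζ ^ (n * c ^ 2)` on the eigenspace of `k` for `ζ ^ c`. -/
def gaussianElement (ζ : 𝕜) (N : ℕ) (k : Aˣ) (n : ℤ) : A :=
  ∑ c ∈ Finset.range N, ζ ^ (n * c ^ 2) • spectralIdem ζ N k c

/-- The Fourier coefficients of `gaussianElement`: those of its expansion in powers of `k`. -/
def gaussianCoeff (ζ : 𝕜) (N : ℕ) (n d : ℤ) : 𝕜 :=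
  (N : 𝕜)⁻¹ * ∑ c ∈ Finset.range N, ζ ^ (n * c ^ 2 - c * d)

theorem commute_zpow_gaussianElement (m n : ℤ) :
    Commute (↑(k ^ m) : A) (gaussianElement ζ N k n) := by
  refine Commute.sum_right _ _ _ fun c _ => .smul_right (.smul_right (Commute.sum_right _ _ _
    fun d _ => .smul_right ?_ _) _) _
  exact ((Commute.refl k).zpow_zpow m d).units_val

theorem zpow_smul_zpow_periodic (hζ : IsPrimitiveRoot ζ N) (hk : k ^ N = 1) (c : ℤ) :
    Function.Periodic (fun d : ℤ => ζ ^ (-(c * d)) • (↑(k ^ d) : A)) N := fun d => by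
  simp only
  rw [units_zpow_add_of_pow_eq_one hk, zpow_eq_zpow_of_modEq hζ]
  exact Int.modEq_iff_dvd.2 ⟨c, by ring⟩

theorem spectralIdem_periodic (hζ : IsPrimitiveRoot ζ N) :
    Function.Periodic (spectralIdem ζ N k) N := fun c => by
  unfold spectralIdem
  congr 1
  refine Finset.sum_congr rfl fun d _ => ?_
  rw [zpow_eq_zpow_of_modEq hζ (m := -((c + N) * d)) (n := -(c * d))
    (Int.modEq_iff_dvd.2 ⟨d, by ring⟩)]

theorem zpow_mul_spectralIdem (hζ : IsPrimitiveRoot ζ N) (hN : N ≠ 0) (hk : k ^ N = 1) (m c : ℤ) :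
    ↑(k ^ m) * spectralIdem ζ N k c = ζ ^ (m * c) • spectralIdem ζ N k c := by
  unfold spectralIdem
  rw [mul_smul_comm, smul_comm (ζ ^ (m * c))]
  congr 1
  have hshift := sum_range_add_of_periodic (zpow_smul_zpow_periodic hζ hk c) m
  rw [Finset.mul_sum, ← hshift, Finset.smul_sum]
  refine Finset.sum_congr rfl fun d _ => ?_
  rw [mul_smul_comm, ← Units.val_mul, ← zpow_add, smul_smul, ← zpow_add₀ (hζ.ne_zero hN),
    add_comm m]
  congr 2
  ring

theorem spectralIdem_mul (hζ : IsPrimitiveRoot ζ N) (hN : N ≠ 0) (hk : k ^ N = 1) (c c' : ℤ) :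
    spectralIdem ζ N k c * spectralIdem ζ N k c' =
      ((N : 𝕜)⁻¹ * ∑ d ∈ Finset.range N, ζ ^ ((c' - c) * d)) • spectralIdem ζ N k c' := by
  nth_rewrite 1 [spectralIdem]
  rw [smul_mul_assoc, Finset.sum_mul, mul_smul, Finset.sum_smul]
  congr 1
  refine Finset.sum_congr rfl fun d _ => ?_
  rw [smul_mul_assoc, zpow_mul_spectralIdem hζ hN hk, smul_smul,
    ← zpow_add₀ (hζ.ne_zero hN)]
  congr 2
  ring

theorem natCast_ne_zero_of_isPrimitiveRoot (hζ : IsPrimitiveRoot ζ N) (hN : N ≠ 0) :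
    (N : 𝕜) ≠ 0 :=
  have : NeZero N := ⟨hN⟩
  hζ.neZero'.out

theorem spectralIdem_mul_self (hζ : IsPrimitiveRoot ζ N) (hN : N ≠ 0) (hk : k ^ N = 1) (c : ℤ) :
    spectralIdem ζ N k c * spectralIdem ζ N k c = spectralIdem ζ N k c := by
  rw [spectralIdem_mul hζ hN hk]
  simp [natCast_ne_zero_of_isPrimitiveRoot hζ hN]

theorem spectralIdem_mul_of_ne (hζ : IsPrimitiveRoot ζ N) (hk : k ^ N = 1) {c c' : ℕ}
    (hc : c < N) (hc' : c' < N) (h : c ≠ c') :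
    spectralIdem ζ N k c * spectralIdem ζ N k c' = 0 := by
  rw [spectralIdem_mul hζ (by omega) hk, sum_zpow_mul_eq_zero hζ, mul_zero, zero_smul]
  intro hd
  have := Int.eq_zero_of_abs_lt_dvd hd (by rw [abs_lt]; omega)
  omega

theorem sum_spectralIdem (hζ : IsPrimitiveRoot ζ N) (hN : N ≠ 0) :
    ∑ c ∈ Finset.range N, spectralIdem ζ N k c = 1 := by
  have hcoeff {d : ℕ} (hd : d ∈ Finset.range N) (hd0 : d ≠ 0) :
      ∑ c ∈ Finset.range N, ζ ^ (-((c : ℤ) * d)) = 0 := by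
    rw [Finset.mem_range] at hd
    rw [← sum_zpow_mul_eq_zero hζ (n := -d)]
    · exact Finset.sum_congr rfl fun c _ => by rw [mul_comm, neg_mul]
    · rw [dvd_neg, Int.natCast_dvd_natCast]
      exact Nat.not_dvd_of_pos_of_lt (Nat.pos_of_ne_zero hd0) hd
  unfold spectralIdem
  rw [← Finset.smul_sum, Finset.sum_comm]
  simp_rw [← Finset.sum_smul]
  rw [Finset.sum_eq_single_of_mem 0 (Finset.mem_range.2 (Nat.pos_of_ne_zero hN))
    fun d hd hd0 => by rw [hcoeff hd hd0, zero_smul]]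
  simp [smul_smul, natCast_ne_zero_of_isPrimitiveRoot hζ hN]

theorem spectralIdem_mul_of_mul_eq_smul (hζ : IsPrimitiveRoot ζ N) (hN : N ≠ 0) {x : A} {j : ℤ}
    (hx : k * x = ζ ^ j • (x * k)) (c : ℤ) :
    spectralIdem ζ N k c * x = x * spectralIdem ζ N k (c - j) := by
  unfold spectralIdem
  rw [smul_mul_assoc, mul_smul_comm, Finset.sum_mul, Finset.mul_sum]
  congr 1
  refine Finset.sum_congr rfl fun d _ => ?_
  have hζ0 := hζ.ne_zero hN
  rw [smul_mul_assoc, units_zpow_mul_of_mul_eq_smul (zpow_ne_zero j hζ0) hx,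
    mul_smul_comm, smul_smul, ← zpow_mul, ← zpow_add₀ hζ0]
  congr 2
  ring

theorem gaussianElement_mul (hζ : IsPrimitiveRoot ζ N) (hN : N ≠ 0) (hk : k ^ N = 1) (m n : ℤ) :
    gaussianElement ζ N k m * gaussianElement ζ N k n = gaussianElement ζ N k (m + n) := by
  unfold gaussianElement
  rw [Finset.sum_mul]
  refine Finset.sum_congr rfl fun c hc => ?_
  rw [Finset.mul_sum, Finset.sum_eq_single_of_mem c hc]
  · rw [smul_mul_smul_comm, spectralIdem_mul_self hζ hN hk, ← zpow_add₀ (hζ.ne_zero hN), add_mul]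
  · intro c' hc' h
    rw [smul_mul_smul_comm, spectralIdem_mul_of_ne hζ hk (Finset.mem_range.1 hc)
      (Finset.mem_range.1 hc') h.symm, smul_zero]

theorem gaussianElement_zero (hζ : IsPrimitiveRoot ζ N) (hN : N ≠ 0) :
    gaussianElement ζ N k 0 = 1 := by
  simp [gaussianElement, sum_spectralIdem hζ hN]

theorem zpow_mul_gaussianElement (hζ : IsPrimitiveRoot ζ N) (hN : N ≠ 0) (hk : k ^ N = 1)
    (m n : ℤ) : ↑(k ^ m) * gaussianElement ζ N k n =
      ∑ c ∈ Finset.range N, ζ ^ (n * c ^ 2 + m * c) • spectralIdem ζ N k c := by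
  rw [gaussianElement, Finset.mul_sum]
  refine Finset.sum_congr rfl fun c _ => ?_
  rw [mul_smul_comm, zpow_mul_spectralIdem hζ hN hk, smul_smul, ← zpow_add₀ (hζ.ne_zero hN)]

theorem gaussianElement_mul_of_mul_eq_smul (hζ : IsPrimitiveRoot ζ N) (hN : N ≠ 0)
    (hk : k ^ N = 1) {x : A} {j : ℤ} (hx : k * x = ζ ^ j • (x * k)) (n : ℤ) :
    gaussianElement ζ N k n * x =
      ζ ^ (n * j ^ 2) • (x * (↑(k ^ (2 * n * j)) * gaussianElement ζ N k n)) := by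
  have hper : Function.Periodic (fun c : ℤ => ζ ^ (n * (c + j) ^ 2) • spectralIdem ζ N k c) N :=
    fun c => by
      simp only
      rw [spectralIdem_periodic hζ, zpow_eq_zpow_of_modEq hζ]
      exact Int.modEq_iff_dvd.2 ⟨-(n * (2 * c + N + 2 * j)), by ring⟩
  have hshift := sum_range_add_of_periodic hper (-j)
  simp only [← sub_eq_add_neg, sub_add_cancel] at hshift
  rw [zpow_mul_gaussianElement hζ hN hk, gaussianElement, Finset.sum_mul, ← mul_smul_comm,
    Finset.smul_sum]
  simp_rw [smul_mul_assoc, spectralIdem_mul_of_mul_eq_smul hζ hN hx, ← mul_smul_comm]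
  rw [← Finset.mul_sum, hshift]
  congr 1
  refine Finset.sum_congr rfl fun c _ => ?_
  rw [smul_smul, ← zpow_add₀ (hζ.ne_zero hN)]
  congr 2
  ring

theorem gaussianElement_neg_one (hζ : IsPrimitiveRoot ζ N) (hN : N ≠ 0) (hk : k ^ N = 1) :
    (gaussianElement ζ N k (-1) : A) = (N : 𝕜)⁻¹ • ∑ b ∈ Finset.range N, ∑ c ∈ Finset.range N,
      ζ ^ (-((b : ℤ) * c)) • ((k ^ (b - c : ℤ) : Aˣ) : A) := by
  rw [gaussianElement, Finset.sum_comm, Finset.smul_sum]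
  refine Finset.sum_congr rfl fun c _ => ?_
  rw [spectralIdem, smul_comm, ← sum_range_add_of_periodic (zpow_smul_zpow_periodic hζ hk c) (-c),
    Finset.smul_sum]
  congr 1
  refine Finset.sum_congr rfl fun b _ => ?_
  rw [smul_smul, ← zpow_add₀ (hζ.ne_zero hN), ← sub_eq_add_neg]
  congr 2
  ring

/-! ### Fourier expansions of Gaussian elements -/

theorem gaussianElement_eq_sum (hζ : IsPrimitiveRoot ζ N) (hN : N ≠ 0) (hk : k ^ N = 1)
    (n m : ℤ) : gaussianElement ζ N k n =
      ∑ d ∈ Finset.range N, gaussianCoeff ζ N n (d + m) • ((k ^ (d + m) : Aˣ) : A) := by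
  have hper : Function.Periodic (fun d : ℤ => gaussianCoeff ζ N n d • (↑(k ^ d) : A)) N :=
    fun d => by
      simp only [gaussianCoeff]
      rw [units_zpow_add_of_pow_eq_one hk]
      congr 2
      refine Finset.sum_congr rfl fun c _ => ?_
      exact zpow_eq_zpow_of_modEq hζ (Int.modEq_iff_dvd.2 ⟨c, by ring⟩)
  rw [sum_range_add_of_periodic hper m]
  simp only [gaussianElement, spectralIdem, gaussianCoeff, Finset.smul_sum, Finset.mul_sum,
    Finset.sum_smul, smul_smul]
  rw [Finset.sum_comm]
  refine Finset.sum_congr rfl fun d _ => Finset.sum_congr rfl fun c _ => ?_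
  rw [mul_left_comm, ← zpow_add₀ (hζ.ne_zero hN), sub_eq_add_neg]

theorem gaussianCoeff_eq_of_modEq (hζ : IsPrimitiveRoot ζ N) (hN : N ≠ 0) {n d e : ℤ}
    (h : d ≡ 2 * n * e [ZMOD N]) : gaussianCoeff ζ N n d =
      ((N : 𝕜)⁻¹ * ∑ c ∈ Finset.range N, ζ ^ (n * c ^ 2)) * ζ ^ (-(n * e ^ 2)) := by
  have hper : Function.Periodic (fun c : ℤ => ζ ^ (n * c ^ 2)) N := fun c =>
    zpow_eq_zpow_of_modEq hζ (Int.modEq_iff_dvd.2 ⟨-(n * (2 * c + N)), by ring⟩)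
  obtain ⟨y, hy⟩ := h.dvd
  rw [gaussianCoeff, mul_assoc, ← sum_range_add_of_periodic hper (-e), Finset.sum_mul]
  congr 1
  refine Finset.sum_congr rfl fun c _ => ?_
  rw [← zpow_add₀ (hζ.ne_zero hN)]
  exact zpow_eq_zpow_of_modEq hζ (Int.modEq_iff_dvd.2 ⟨-(c * y), by linear_combination -c * hy⟩)

theorem gaussianCoeff_of_odd (hζ : IsPrimitiveRoot ζ N) {t : ℤ} (hN : (N : ℤ) = 2 * t - 1)
    (ε : ℤˣ) (d : ℤ) : gaussianCoeff ζ N ε d =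
      ((N : 𝕜)⁻¹ * ∑ c ∈ Finset.range N, ζ ^ ((ε : ℤ) * c ^ 2)) * ζ ^ (-(ε * (t * d) ^ 2)) := by
  have hsq := Int.units_coe_mul_self ε
  rw [gaussianCoeff_eq_of_modEq hζ (by omega) (e := ε * (t * d))]
  · congr 2
    linear_combination -ε * t ^ 2 * d ^ 2 * hsq
  · exact Int.modEq_iff_dvd.2 ⟨d, by rw [hN]; linear_combination 2 * t * d * hsq⟩

theorem gaussianCoeff_two_mul (hζ : IsPrimitiveRoot ζ N) (hN : N ≠ 0) (ε : ℤˣ) (e : ℤ) :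
    gaussianCoeff ζ N ε (2 * e) =
      ((N : 𝕜)⁻¹ * ∑ c ∈ Finset.range N, ζ ^ ((ε : ℤ) * c ^ 2)) * ζ ^ (-(ε * e ^ 2)) := by
  have hsq := Int.units_coe_mul_self ε
  rw [gaussianCoeff_eq_of_modEq hζ hN (e := ε * e)]
  · congr 2
    linear_combination -ε * e ^ 2 * hsq
  · rw [show 2 * (ε : ℤ) * (ε * e) = 2 * e by linear_combination 2 * e * hsq]

theorem gaussianCoeff_summand_add_half {P : ℕ} (hζ : IsPrimitiveRoot ζ (2 * P)) (hP : P ≠ 0)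
    (n d c : ℤ) : ζ ^ (n * (c + P) ^ 2 - (c + P) * d) =
      (ζ ^ P) ^ (n * P - d) * ζ ^ (n * c ^ 2 - c * d) := by
  rw [← zpow_natCast, ← zpow_mul, ← zpow_add₀ (hζ.ne_zero (by omega))]
  exact zpow_eq_zpow_of_modEq hζ (Int.modEq_iff_dvd.2 ⟨-(n * c), by push_cast; ring⟩)

theorem gaussianCoeff_eq_zero_of_odd {P : ℕ} (hζ : IsPrimitiveRoot ζ (2 * P))
    (hP : P ≠ 0) {n d : ℤ} (hd : Odd (n * P - d)) : gaussianCoeff ζ (2 * P) n d = 0 := by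
  have hhalf : ζ ^ P = -1 := (hζ.pow (by omega) (mul_comm 2 P)).eq_neg_one_of_two_right
  have hper : Function.Periodic (fun c : ℤ => ζ ^ (n * c ^ 2 - c * d)) (2 * P : ℕ) := fun c =>
    zpow_eq_zpow_of_modEq hζ
      (Int.modEq_iff_dvd.2 ⟨d - n * (2 * c + (2 * P : ℕ)), by ring⟩)
  have hshift := sum_range_add_of_periodic hper P
  simp only [gaussianCoeff_summand_add_half hζ hP, hhalf, hd.neg_one_zpow, neg_one_mul,
    Finset.sum_neg_distrib] at hshift
  have h2P := natCast_ne_zero_of_isPrimitiveRoot hζ (by omega)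
  rw [Nat.cast_mul, Nat.cast_ofNat] at h2P
  refine mul_eq_zero_of_right _ ((mul_right_inj' (left_ne_zero_of_mul h2P)).1 ?_)
  linear_combination -hshift

theorem gaussianCoeff_two_mul_of_odd {M : ℕ} (hζ : IsPrimitiveRoot ζ (2 * M)) (hM : Odd M)
    {n d : ℤ} (hn : Odd n) (hd : Odd d) :
    gaussianCoeff ζ (2 * M) n d = gaussianCoeff (ζ ^ 2) M (2 * n) d := by
  have hM0 : M ≠ 0 := hM.pos.ne'
  obtain ⟨t, ht⟩ := hM
  have hper : Function.Periodic (fun c : ℤ => ζ ^ (n * c ^ 2 - c * d)) M := fun c => by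
    have heven : Even (n * M - d) := (hn.mul ⟨t, by rw [ht]; push_cast; rfl⟩).sub_odd hd
    have hhalf : ζ ^ M * ζ ^ M = 1 := by rw [← pow_add, ← two_mul, hζ.pow_eq_one]
    obtain ⟨y, hy⟩ := heven
    simp only
    rw [gaussianCoeff_summand_add_half hζ hM0, hy, zpow_add', ← mul_zpow, hhalf, one_zpow, one_mul]
    exact .inl (pow_ne_zero _ (hζ.ne_zero (by omega)))
  have hdouble : Function.Periodic (fun c : ℤ => ζ ^ (n * (2 * c) ^ 2 - 2 * c * d)) M := fun c => by
    have := (hper (2 * c + M)).trans (hper (2 * c))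
    rwa [add_assoc, ← two_mul, ← mul_add] at this
  have hodd : ∑ c ∈ Finset.range M, ζ ^ (n * ((2 * c + 1 : ℕ) : ℤ) ^ 2 - (2 * c + 1 : ℕ) * d) =
      ∑ c ∈ Finset.range M, ζ ^ (n * (2 * (c : ℤ)) ^ 2 - 2 * c * d) := by
    rw [← sum_range_add_of_periodic hdouble (t + 1)]
    refine Finset.sum_congr rfl fun c _ => ?_
    have hc : ((2 * c + 1 : ℕ) : ℤ) + M = 2 * (c + (t + 1)) := by rw [ht]; push_cast; ring
    rw [← hc]
    exact (hper _).symm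
  have hinv : ((2 * M : ℕ) : 𝕜)⁻¹ * 2 = (M : 𝕜)⁻¹ := by
    have h0 := natCast_ne_zero_of_isPrimitiveRoot hζ (by omega)
    push_cast at h0 ⊢
    rw [mul_inv_rev, inv_mul_cancel_right₀ (left_ne_zero_of_mul h0)]
  rw [gaussianCoeff, sum_range_two_mul, hodd, gaussianCoeff, ← hinv, mul_assoc]
  push_cast
  rw [← two_mul]
  congr 2
  refine Finset.sum_congr rfl fun c _ => ?_
  rw [← zpow_natCast, ← zpow_mul]
  congr 1
  push_cast
  ring

theorem gaussianElement_eq_of_odd (hζ : IsPrimitiveRoot ζ N) (hk : k ^ N = 1) {t : ℤ}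
    (hN : (N : ℤ) = 2 * t - 1) (ε : ℤˣ) (m : ℤ) : gaussianElement ζ N k ε =
      ((N : 𝕜)⁻¹ * ∑ c ∈ Finset.range N, ζ ^ ((ε : ℤ) * c ^ 2)) • ∑ b ∈ Finset.range N,
        ζ ^ (-(ε * (t * (b + m)) ^ 2)) • ((k ^ (b + m) : Aˣ) : A) := by
  rw [gaussianElement_eq_sum hζ (by omega) hk ε m, Finset.smul_sum]
  exact Finset.sum_congr rfl fun b _ => by rw [gaussianCoeff_of_odd hζ hN, smul_smul]

theorem odd_units_int (ε : ℤˣ) : Odd (ε : ℤ) := by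
  obtain rfl | rfl := Int.units_eq_one_or ε <;> decide

theorem gaussianCoeff_of_two_mul_odd {M : ℕ} (hζ : IsPrimitiveRoot ζ (2 * M)) {t : ℤ}
    (hM : (M : ℤ) = 2 * t - 1) (ε : ℤˣ) {d : ℤ} (hd : Odd d) : gaussianCoeff ζ (2 * M) ε d =
      ((M : 𝕜)⁻¹ * ∑ c ∈ Finset.range M, ζ ^ (4 * (ε : ℤ) * c ^ 2)) *
        ζ ^ (-(2 * ε * t ^ 3 * d ^ 2)) := by
  have hsq := Int.units_coe_mul_self ε
  have hMo : Odd (M : ℤ) := ⟨t - 1, by rw [hM]; ring⟩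
  rw [gaussianCoeff_two_mul_of_odd hζ (by exact_mod_cast hMo) (odd_units_int ε) hd,
    gaussianCoeff_eq_of_modEq (hζ.pow (by omega) rfl) (by omega) (e := ε * t ^ 2 * d)]
  · simp only [← zpow_natCast ζ, ← zpow_mul]
    congr 1
    · congr 1
      refine Finset.sum_congr rfl fun c _ => ?_
      congr 1
      push_cast
      ring
    · refine zpow_eq_zpow_of_modEq hζ (Int.modEq_iff_dvd.2 ⟨ε * t ^ 3 * d ^ 2, ?_⟩)
      push_cast
      rw [hM]
      linear_combination 4 * ε * t ^ 4 * d ^ 2 * hsq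
  · refine Int.modEq_iff_dvd.2 ⟨(2 * t + 1) * d, ?_⟩
    rw [hM]
    linear_combination 4 * t ^ 2 * d * hsq

theorem gaussianElement_eq_of_two_mul_odd {M : ℕ} (hζ : IsPrimitiveRoot ζ (2 * M))
    (hk : k ^ (2 * M) = 1) {t : ℤ} (hM : (M : ℤ) = 2 * t - 1) (ε : ℤˣ) {m : ℤ} (hm : Odd m) :
    gaussianElement ζ (2 * M) k ε =
      ((M : 𝕜)⁻¹ * ∑ c ∈ Finset.range M, ζ ^ (4 * (ε : ℤ) * c ^ 2)) • ∑ b ∈ Finset.range M,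
        ζ ^ (-(2 * ε * t ^ 3 * (2 * b + m) ^ 2)) • ((k ^ (2 * b + m) : Aˣ) : A) := by
  have hMo : Odd (M : ℤ) := ⟨t - 1, by rw [hM]; ring⟩
  rw [gaussianElement_eq_sum hζ (by omega) hk ε m, sum_range_two_mul, Finset.smul_sum,
    Finset.sum_eq_zero (f := fun b : ℕ => gaussianCoeff ζ (2 * M) ε ((2 * b + 1 : ℕ) + m) • _),
    add_zero]
  · refine Finset.sum_congr rfl fun b _ => ?_
    push_cast
    rw [gaussianCoeff_of_two_mul_odd hζ hM ε ((even_two_mul _).add_odd hm), smul_smul]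
  · intro b _
    rw [gaussianCoeff_eq_zero_of_odd hζ (by omega), zero_smul]
    refine ((odd_units_int ε).mul hMo).sub_even ?_
    push_cast
    exact (even_two_mul _).add_one.add_odd hm

theorem gaussianElement_eq_of_two_mul_even {P : ℕ} (hζ : IsPrimitiveRoot ζ (2 * P))
    (hk : k ^ (2 * P) = 1) (hP0 : P ≠ 0) (hP : Even P) (ε : ℤˣ) :
    gaussianElement ζ (2 * P) k ε =
      (((2 * P : ℕ) : 𝕜)⁻¹ * ∑ c ∈ Finset.range (2 * P), ζ ^ ((ε : ℤ) * c ^ 2)) •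
        ∑ b ∈ Finset.range P, ζ ^ (-((ε : ℤ) * b ^ 2)) • ((k ^ (2 * b : ℤ) : Aˣ) : A) := by
  rw [gaussianElement_eq_sum hζ (by omega) hk ε 0, Finset.smul_sum]
  simp only [add_zero]
  rw [sum_range_two_mul (fun d : ℕ => gaussianCoeff ζ (2 * P) ε d • ((k ^ (d : ℤ) : Aˣ) : A)),
    Finset.sum_eq_zero (f := fun b : ℕ => gaussianCoeff ζ (2 * P) ε (2 * b + 1 : ℕ) • _), add_zero]
  · refine Finset.sum_congr rfl fun b _ => ?_
    push_cast
    rw [gaussianCoeff_two_mul hζ (by omega), smul_smul]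
    push_cast
    rfl
  · intro b _
    rw [gaussianCoeff_eq_zero_of_odd hζ hP0, zero_smul]
    push_cast
    exact (((Int.even_coe_nat P).2 hP).mul_left ε).sub_odd (even_two_mul _).add_one

end

/-! ### Commutation relations in the small quantum group -/

section

variable (r : ℕ)

theorem K_pow_r₁ : K r ^ r₁ r = 1 := Units.ext <| by
  rw [Units.val_pow_eq_pow_val]
  exact gen_K_pow r

theorem F_pow_r₁ : F r ^ r₁ r = 0 := gen_F_pow r

theorem K_mul_E_pow (a : ℕ) : K r * E r ^ a = q r ^ (2 * (a : ℤ)) • (E r ^ a * K r) := by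
  rw [zpow_mul, zpow_natCast]
  exact y_mul_x_pow (K_mul_E r) a

theorem K_mul_F_pow (a : ℕ) : K r * F r ^ a = q r ^ (2 * -(a : ℤ)) • (F r ^ a * K r) := by
  rw [mul_neg, ← neg_mul, zpow_mul, zpow_natCast]
  exact y_mul_x_pow (K_mul_F r) a

theorem K_mul_F_pow_mul_E_pow (a : ℕ) :
    K r * (F r ^ a * E r ^ a) = q r ^ (2 * 0 : ℤ) • (F r ^ a * E r ^ a * K r) := by
  rw [← mul_assoc, K_mul_F_pow, smul_mul_assoc, mul_assoc, K_mul_E_pow, mul_smul_comm, smul_smul,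
    ← zpow_add₀ (q_ne_zero r), mul_assoc, ← mul_add, neg_add_cancel]

theorem zpow_mul_E_pow (m : ℤ) (a : ℕ) :
    ↑(K r ^ m) * E r ^ a = q r ^ (2 * (m * a)) • (E r ^ a * ↑(K r ^ m)) := by
  rw [units_zpow_mul_of_mul_eq_smul (zpow_ne_zero _ (q_ne_zero r)) (K_mul_E_pow r a), ← zpow_mul]
  congr 2
  ring

theorem zpow_mul_F (m : ℤ) : ↑(K r ^ m) * F r = q r ^ (-(2 * m)) • (F r * ↑(K r ^ m)) := by
  rw [units_zpow_mul_of_mul_eq_smul (zpow_ne_zero _ (q_ne_zero r)) (K_mul_F r), ← zpow_mul, neg_mul]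

/-- The product `K ^ m * γ_n`, where `γ_n` is the Gaussian element of `K` at `q ^ 2`. It acts as
`q ^ (2 * (m * c + n * c ^ 2))` on the eigenspace of `K` for `q ^ (2 * c)`, and the ribbon element
and its inverse are combinations of the products `F ^ a * E ^ a * cartan r m n`. -/
def cartan (m n : ℤ) : SmallQuantumSl2 r :=
  ↑(K r ^ m) * gaussianElement (q r ^ (2 : ℤ)) (r₁ r) (K r) n

theorem zpow_mul_cartan (m m' n : ℤ) : ↑(K r ^ m) * cartan r m' n = cartan r (m + m') n := by
  rw [cartan, cartan, zpow_add, Units.val_mul, mul_assoc]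

end

section

variable (r : ℕ) [Fact (2 < r)]

theorem cartan_mul_cartan (m m' n n' : ℤ) :
    cartan r m n * cartan r m' n' = cartan r (m + m') (n + n') := by
  rw [cartan, cartan, cartan, ← gaussianElement_mul (q_sq_primitive r) (r₁_pos r).ne' (K_pow_r₁ r),
    zpow_add, Units.val_mul]
  exact (commute_zpow_gaussianElement m' n).symm.mul_mul_mul_comm _ _

theorem cartan_zero_right (m : ℤ) : cartan r m 0 = ↑(K r ^ m) := by
  rw [cartan, gaussianElement_zero (q_sq_primitive r) (r₁_pos r).ne', mul_one]

theorem cartan_mul_of_K_mul {x : SmallQuantumSl2 r} {j : ℤ}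
    (hx : K r * x = q r ^ (2 * j) • (x * K r)) (m n : ℤ) :
    cartan r m n * x = q r ^ (2 * (m * j + n * j ^ 2)) • (x * cartan r (m + 2 * n * j) n) := by
  have hq := q_ne_zero r
  have hx' : K r * x = (q r ^ (2 : ℤ)) ^ j • (x * K r) := by rw [hx, zpow_mul]
  rw [cartan, cartan, mul_assoc, gaussianElement_mul_of_mul_eq_smul (q_sq_primitive r)
    (r₁_pos r).ne' (K_pow_r₁ r) hx', mul_smul_comm, ← mul_assoc,
    units_zpow_mul_of_mul_eq_smul (zpow_ne_zero _ hq) hx, smul_mul_assoc, smul_smul, ← zpow_mul,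
    ← zpow_mul, ← zpow_add₀ hq, mul_assoc x, zpow_add, Units.val_mul, mul_assoc (K r ^ m).val]
  congr 2
  ring

theorem cartan_mul_E_pow (m n : ℤ) (a : ℕ) : cartan r m n * E r ^ a =
    q r ^ (2 * (m * a + n * a ^ 2)) • (E r ^ a * cartan r (m + 2 * n * a) n) :=
  cartan_mul_of_K_mul r (K_mul_E_pow r a) m n

theorem cartan_mul_F (m n : ℤ) :
    cartan r m n * F r = q r ^ (2 * (n - m)) • (F r * cartan r (m - 2 * n) n) := by
  have h := cartan_mul_of_K_mul r (K_mul_F_pow r 1) m n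
  rw [pow_one] at h
  rw [h]
  congr 3 <;> push_cast <;> ring

theorem commute_cartan_F_pow_mul_E_pow (m n : ℤ) (a : ℕ) :
    Commute (cartan r m n) (F r ^ a * E r ^ a) := by
  simpa [Commute, SemiconjBy] using cartan_mul_of_K_mul r (K_mul_F_pow_mul_E_pow r a) m n

theorem brace_ne_zero {n : ℤ} (h : ¬(r₁ r : ℤ) ∣ n) : brace r n ≠ 0 := fun h0 => by
  refine h (((q_sq_primitive r).zpow_eq_one_iff_dvd n).1 ?_)
  rw [← zpow_mul, two_mul, zpow_add₀ (q_ne_zero r)]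
  nth_rewrite 1 [sub_eq_zero.1 h0]
  rw [← zpow_add₀ (q_ne_zero r), neg_add_cancel, zpow_zero]

theorem one_lt_r₁ : 1 < r₁ r := by
  have hr : 2 < r := Fact.out
  have hgcd : Nat.gcd r 2 ≤ 2 := Nat.gcd_le_right _ two_pos
  have hmul : Nat.gcd r 2 * r₁ r = r := Nat.mul_div_cancel' (Nat.gcd_dvd_left r 2)
  nlinarith

theorem brace_ne_zero_of_lt {n : ℕ} (h0 : 0 < n) (h : n < r₁ r) : brace r n ≠ 0 :=
  brace_ne_zero r fun hdvd => (Nat.le_of_dvd h0 (Int.natCast_dvd_natCast.1 hdvd)).not_gt h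

theorem brace_one_ne_zero : brace r 1 ≠ 0 := by
  simpa using brace_ne_zero_of_lt r one_pos (one_lt_r₁ r)

theorem qInt_ne_zero {n : ℕ} (h0 : 0 < n) (h : n < r₁ r) : qInt r n ≠ 0 :=
  div_ne_zero (brace_ne_zero_of_lt r h0 h) (brace_one_ne_zero r)

theorem qInt_one : qInt r 1 = 1 := div_self (brace_one_ne_zero r)

end

section

variable (r : ℕ)

theorem qInt_zero : qInt r 0 = 0 := by simp [qInt, brace]

theorem qFact_succ (n : ℕ) : qFact r (n + 1) = qFact r n * qInt r (n + 1) :=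
  Finset.prod_range_succ _ _

theorem qInt_add (ε : ℤˣ) (m n : ℤ) :
    qInt r (m + n) = q r ^ (ε * n) * qInt r m + q r ^ (-(ε * m)) * qInt r n := by
  have hq := q_ne_zero r
  rcases Int.units_eq_one_or ε with rfl | rfl <;>
  · simp only [qInt, brace, neg_add, zpow_add₀ hq, Units.val_one, Units.val_neg, one_mul, neg_mul,
      neg_neg]
    ring

theorem brace_neg (n : ℤ) : brace r (-n) = -brace r n := by simp [brace]

theorem brace_units (ε : ℤˣ) : brace r ε = (ε : ℤ) * brace r 1 := by
  rcases Int.units_eq_one_or ε with rfl | rfl <;> simp [brace]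

theorem E_mul_F_eq_add (ε : ℤˣ) : E r * F r = F r * E r +
    ((ε : ℤ) / brace r 1 : ℂ) • ((K r ^ (ε : ℤ)).val - (K r ^ (-ε : ℤ)).val) := by
  have h : E r * F r = F r * E r + (brace r 1)⁻¹ • ((K r : SmallQuantumSl2 r) - ↑(K r)⁻¹) := by
    rw [brace, zpow_neg, zpow_one]
    exact E_mul_F r
  rcases Int.units_eq_one_or ε with rfl | rfl
  · simpa using h
  · rw [h, ← neg_sub, smul_neg]
    simp [neg_div]

end

theorem E_pow_succ_mul_F (r : ℕ) [Fact (2 < r)] (ε : ℤˣ) (a : ℕ) :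
    E r ^ (a + 1) * F r = F r * E r ^ (a + 1) + ((ε : ℤ) / brace r 1 * qInt r (a + 1)) •
      (E r ^ a * (q r ^ (ε * a : ℤ) • (K r ^ (ε : ℤ)).val -
        q r ^ (-(ε * a) : ℤ) • (K r ^ (-ε : ℤ)).val)) := by
  have hq := q_ne_zero r
  induction a with
  | zero => simp [E_mul_F_eq_add r ε, qInt_one]
  | succ a ih =>
    have hadd : qInt r (a + 1 + 1) =
        q r ^ (ε : ℤ) * qInt r (a + 1) + q r ^ (-(ε * (a + 1)) : ℤ) := by
      simpa [qInt_one] using qInt_add r ε (a + 1) 1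
    have hadd' : qInt r (a + 1 + 1) =
        q r ^ (ε * (a + 1) : ℤ) + q r ^ (-ε : ℤ) * qInt r (a + 1) := by
      simpa [qInt_one, add_comm] using qInt_add r ε 1 (a + 1)
    rw [pow_succ', mul_assoc, ih, mul_add, ← mul_assoc, E_mul_F_eq_add r ε, add_mul,
      mul_assoc, ← pow_succ', add_assoc]
    congr 1
    rw [smul_mul_assoc, sub_mul, zpow_mul_E_pow, zpow_mul_E_pow, mul_smul_comm,
      ← mul_assoc (E r), ← pow_succ']
    simp only [mul_sub, mul_smul_comm, smul_sub, smul_smul]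
    rw [sub_add_sub_comm, ← add_smul, ← add_smul]
    push_cast
    congr 2
    · rw [hadd']
      simp only [mul_add, mul_one, two_mul, zpow_add₀ hq, zpow_neg]
      field_simp
    · rw [hadd]
      simp only [mul_add, mul_one, two_mul, zpow_add₀ hq, zpow_neg, neg_mul, neg_add]
      field_simp
      ring

/-! ### The ribbon element and its inverse -/

theorem two_mul_add_three_mul_ediv_two (a : ℕ) :
    2 * (((a : ℤ) + 3) * a / 2) = ((a : ℤ) + 3) * a := by
  refine Int.mul_ediv_cancel' (even_iff_two_dvd.1 ?_)
  rcases Int.even_or_odd (a : ℤ) with h | h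
  · exact h.mul_left _
  · exact (h.add_odd (by decide)).mul_right _

/-- The scalar coefficient of the term with `F ^ a * E ^ a` in `ribbonForm r ε`. -/
def ribbonCoeff (r : ℕ) (ε : ℤˣ) (a : ℕ) : ℂ :=
  brace r (-ε) ^ a / qFact r a * q r ^ (-(ε * (((a : ℤ) + 3) * a / 2)))

/-- The common normal form of the ribbon element `v₊` (`ε = 1`) and of its inverse `v₋` (`ε = -1`),
with the powers of `K` collected into Gaussian elements. -/
def ribbonForm (r : ℕ) (ε : ℤˣ) : SmallQuantumSl2 r :=
  ∑ a ∈ Finset.range (r₁ r), ribbonCoeff r ε a •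
    (F r ^ a * E r ^ a * cartan r (-(ε * (a + 1))) (-ε))

section

variable (r : ℕ)

theorem ribbonCoeff_neg_mul_ribbonCoeff (ε : ℤˣ) (a b : ℕ) :
    ribbonCoeff r (-ε) a * ribbonCoeff r ε b * q r ^ (-(2 * (ε * (a * (a + b + 1)))) : ℤ) =
      brace r (-ε) ^ (a + b) * q r ^ (-(ε * (((a + b : ℕ) + 3) * (a + b : ℕ) / 2)) : ℤ) *
        ((-1) ^ a * q r ^ (-(ε * (a * (a + b - 1))) : ℤ) / (qFact r a * qFact r b)) := by
  have hexp : (ε * (((a : ℤ) + 3) * a / 2) + -(ε * (((b : ℤ) + 3) * b / 2)) +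
      -(2 * (ε * (a * (a + b + 1)))) : ℤ) =
      -(ε * (((a + b : ℕ) + 3) * (a + b : ℕ) / 2)) + -(ε * (a * (a + b - 1))) := by
    have ha := two_mul_add_three_mul_ediv_two a
    have hb := two_mul_add_three_mul_ediv_two b
    have hab := two_mul_add_three_mul_ediv_two (a + b)
    refine mul_left_cancel₀ (two_ne_zero (α := ℤ)) ?_
    push_cast at *
    linear_combination (ε : ℤ) * (ha - hb + hab)
  have hpow := congrArg (q r ^ ·) hexp
  simp only [zpow_add₀ (q_ne_zero r)] at hpow
  have hbrace : brace r ε ^ a = brace r (-ε) ^ a * (-1) ^ a := by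
    rw [brace_neg, ← mul_pow, neg_mul_comm, neg_neg, mul_one]
  simp only [ribbonCoeff, Units.val_neg, neg_neg, neg_mul (ε : ℤ), hbrace, pow_add]
  linear_combination (brace r (-ε) ^ a * brace r (-ε) ^ b * (-1) ^ a /
    (qFact r a * qFact r b)) * hpow

theorem antipodeLin_pow (x : SmallQuantumSl2 r) (n : ℕ) :
    antipodeLin r (x ^ n) = antipodeLin r x ^ n := by
  simp [antipodeLin]

theorem antipodeLin_K_pow (n : ℕ) :
    antipodeLin r (K r ^ n : (SmallQuantumSl2 r)ˣ) = (K r ^ (-n : ℤ)).val := by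
  rw [Units.val_pow_eq_pow_val, antipodeLin_pow, zpow_neg, zpow_natCast, ← inv_pow,
    Units.val_pow_eq_pow_val]
  exact congrArg (· ^ n) (antipodeLin_gen r).1

theorem pow_K_mul_F (a : ℕ) :
    (K r * F r) ^ a = q r ^ (-((a : ℤ) * (a + 1))) • (F r ^ a * (K r ^ (a : ℤ)).val) := by
  induction a with
  | zero => simp
  | succ a ih =>
    rw [pow_succ, ih, smul_mul_assoc, mul_assoc, ← mul_assoc _ (K r).val, ← Units.val_mul,
      ← zpow_add_one, zpow_mul_F,
      mul_smul_comm, smul_smul, ← zpow_add₀ (q_ne_zero r), ← mul_assoc,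
      ← pow_succ]
    push_cast
    congr 2
    ring_nf

theorem antipodeLin_F_pow (a : ℕ) : antipodeLin r (F r ^ a) =
    ((-1) ^ a * q r ^ (-((a : ℤ) * (a + 1)))) • (F r ^ a * (K r ^ (a : ℤ)).val) := by
  have h : antipodeLin r (F r) = (-1 : ℂ) • (K r * F r) :=
    (antipodeLin_gen r).2.2.2.trans (neg_one_smul ℂ _).symm
  rw [antipodeLin_pow, h, smul_pow, pow_K_mul_F, smul_smul]

theorem antipodeLin_mul_K_pow_mul_E_pow (a b c : ℕ) :
    antipodeLin r ((K r ^ c).val * F r ^ a) * ((K r ^ b).val * E r ^ a) =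
      ((-1) ^ a * q r ^ (-((a : ℤ) * (a + 1)))) •
        (F r ^ a * ((K r ^ (a : ℤ)).val * (K r ^ (b - c : ℤ)).val * E r ^ a)) := by
  rw [antipodeLin_mul, antipodeLin_F_pow, antipodeLin_K_pow, smul_mul_assoc, smul_mul_assoc,
    sub_eq_neg_add, zpow_add, zpow_natCast _ b, Units.val_mul]
  simp only [mul_assoc]

end

section

open Finset.HasAntidiagonal (antidiagonal mem_antidiagonal)

variable (r : ℕ) [Fact (2 < r)]

theorem F_pow_mul_E_pow_mul_cartan_neg_one (a : ℕ) :
    F r ^ a * E r ^ a * cartan r (-a) (-1) = F r ^ a * (cartan r a (-1) * E r ^ a) := by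
  rw [cartan_mul_E_pow, mul_assoc]
  ring_nf
  simp

theorem drinfeldElement_rMatrix : drinfeldElement (rMatrix r) =
    ∑ a ∈ Finset.range (r₁ r), ribbonCoeff r 1 a •
      (F r ^ a * E r ^ a * cartan r (-a) (-1)) := by
  have hS (x : SmallQuantumSl2 r) : HopfAlgebra.antipode ℂ x = antipodeLin r x := rfl
  simp only [drinfeldElement, rMatrix, map_smul, map_sum, TensorProduct.comm_tmul,
    LinearMap.rTensor_tmul, LinearMap.mul'_apply, hS, antipodeLin_mul_K_pow_mul_E_pow]
  rw [Finset.smul_sum]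
  refine Finset.sum_congr rfl fun a _ => ?_
  rw [F_pow_mul_E_pow_mul_cartan_neg_one, cartan,
    gaussianElement_neg_one (q_sq_primitive r) (r₁_pos r).ne' (K_pow_r₁ r)]
  simp only [mul_smul_comm, smul_mul_assoc, Finset.mul_sum, Finset.sum_mul, Finset.smul_sum,
    smul_smul]
  refine Finset.sum_congr rfl fun b _ => Finset.sum_congr rfl fun c _ => ?_
  congr 1
  have htri := two_mul_add_three_mul_ediv_two a
  have hpow : q r ^ ((a : ℤ) * (a - 1) / 2 - 2 * b * c) * q r ^ (-((a : ℤ) * (a + 1))) =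
      q r ^ (-(((a : ℤ) + 3) * a / 2)) * (q r ^ (2 : ℤ)) ^ (-((b : ℤ) * c)) := by
    rw [← zpow_mul, ← zpow_add₀ (q_ne_zero r), ← zpow_add₀ (q_ne_zero r),
      show (a : ℤ) * (a - 1) = (a + 3) * a + (-2 * a) * 2 by ring,
      Int.add_mul_ediv_right _ _ two_ne_zero]
    congr 1
    linarith
  rw [ribbonCoeff, Units.val_one, one_mul, brace_neg, neg_pow (brace r 1)]
  linear_combination (1 / (r₁ r : ℂ) * (brace r 1 ^ a / qFact r a) * (-1) ^ a) * hpow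

theorem ribbonElement_eq_ribbonForm : ribbonElement r = ribbonForm r 1 := by
  have hK (a : ℕ) : (K r ^ (-1 : ℤ)).val * (F r ^ a * E r ^ a) =
      F r ^ a * E r ^ a * (K r ^ (-1 : ℤ)).val := by
    rw [← cartan_zero_right]
    exact commute_cartan_F_pow_mul_E_pow r (-1) 0 a
  rw [ribbonElement, pivotal, ← zpow_neg_one, drinfeldElement_rMatrix, ribbonForm, Finset.mul_sum]
  refine Finset.sum_congr rfl fun a _ => ?_
  rw [mul_smul_comm, ← mul_assoc, hK, mul_assoc, zpow_mul_cartan]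
  simp

theorem ribbonCoeff_succ (ε : ℤˣ) {a : ℕ} (ha : a + 1 < r₁ r) :
    ribbonCoeff r ε (a + 1) * ((ε : ℤ) / brace r 1 * qInt r (a + 1)) =
      -(ribbonCoeff r ε a * q r ^ (-(ε * (a + 2)) : ℤ)) := by
  have hInt := qInt_ne_zero r (Nat.succ_pos a) ha
  have hbrace := brace_one_ne_zero r
  have htri : (((a + 1 : ℕ) : ℤ) + 3) * (a + 1 : ℕ) / 2 = ((a : ℤ) + 3) * a / 2 + (a + 2) := by
    rw [← Int.add_mul_ediv_right _ _ two_ne_zero]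
    congr 1
    push_cast
    ring
  have hε : ((ε : ℤ) : ℂ) * (ε : ℤ) = 1 := by exact_mod_cast Int.units_coe_mul_self ε
  rw [Nat.cast_succ] at hInt
  rw [ribbonCoeff, ribbonCoeff, htri, qFact_succ, brace_neg, brace_units, mul_add, neg_add,
    zpow_add₀ (q_ne_zero r), pow_succ]
  field_simp
  linear_combination (-q r ^ (-(ε * (((a : ℤ) + 3) * a / 2)) : ℤ) *
    q r ^ (-(ε * (a + 2)) : ℤ) / qFact r a) * hε

theorem sum_range_succ_of_telescoping {M : Type*} [AddCommGroup M] {t G H : ℕ → M} {n : ℕ}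
    (hzero : t 0 = G 0) (hsucc : ∀ a < n, t (a + 1) = G (a + 1) + (H a - G a)) :
    ∑ a ∈ Finset.range (n + 1), t a = ∑ a ∈ Finset.range n, H a + G n := by
  induction n with
  | zero => simpa using hzero
  | succ n ih =>
    rw [Finset.sum_range_succ, ih fun a ha => hsucc a (ha.trans n.lt_succ_self),
      hsucc n n.lt_succ_self, Finset.sum_range_succ]
    abel

theorem cartan_neg_units_mul_F (ε : ℤˣ) (a : ℕ) : cartan r (-(ε * (a + 1))) (-ε) * F r =
    q r ^ (2 * (ε * a) : ℤ) • (F r * cartan r (-(ε * (a - 1))) (-ε)) := by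
  rw [cartan_mul_F]
  congr 3 <;> ring

theorem ribbonCoeff_succ_smul_mul_F (ε : ℤˣ) {a : ℕ} (ha : a + 1 < r₁ r) :
    ribbonCoeff r ε (a + 1) • (F r ^ (a + 1) * E r ^ (a + 1) *
        cartan r (-(ε * ((a + 1 : ℕ) + 1))) (-ε)) * F r =
      (ribbonCoeff r ε (a + 1) * q r ^ (2 * (ε * (a + 1 : ℕ)) : ℤ)) •
        (F r ^ (a + 1 + 1) * E r ^ (a + 1) * cartan r (-(ε * ((a + 1 : ℕ) - 1))) (-ε)) +
      (ribbonCoeff r ε a • (F r ^ (a + 1) * E r ^ a * cartan r (-(ε * (a + 1))) (-ε)) -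
        (ribbonCoeff r ε a * q r ^ (2 * (ε * a) : ℤ)) •
          (F r ^ (a + 1) * E r ^ a * cartan r (-(ε * (a - 1))) (-ε))) := by
  have hq := q_ne_zero r
  have hm : (ε + -(ε * ((a + 1 : ℕ) - 1)) : ℤ) = -(ε * (a - 1)) := by push_cast; ring
  have hm' : (-ε + -(ε * ((a + 1 : ℕ) - 1)) : ℤ) = -(ε * (a + 1)) := by push_cast; ring
  rw [smul_mul_assoc, mul_assoc, cartan_neg_units_mul_F, mul_smul_comm, smul_smul, mul_assoc,
    ← mul_assoc (E r ^ (a + 1)), E_pow_succ_mul_F r ε, add_mul, mul_add, smul_add]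
  congr 1
  · rw [pow_succ (F r) (a + 1)]
    simp only [mul_assoc]
  rw [smul_mul_assoc, mul_smul_comm, smul_smul, mul_right_comm, ribbonCoeff_succ r ε ha,
    mul_assoc (E r ^ a), sub_mul, smul_mul_assoc, smul_mul_assoc, zpow_mul_cartan, zpow_mul_cartan,
    hm, hm']
  simp only [mul_sub, smul_sub, mul_smul_comm, smul_smul, mul_assoc (F r ^ (a + 1))]
  have hexp : (-(ε * (a + 2)) : ℤ) + 2 * (ε * (a + 1 : ℕ)) + ε * a = 2 * (ε * a) := by
    push_cast; ring
  have hexp' : (-(ε * (a + 2)) : ℤ) + 2 * (ε * (a + 1 : ℕ)) + -(ε * a) = 0 := by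
    push_cast; ring
  rw [neg_mul, neg_mul, neg_mul]
  simp only [mul_assoc (ribbonCoeff r ε a), ← zpow_add₀ hq]
  rw [hexp, hexp', zpow_zero, mul_one (ribbonCoeff r ε a), neg_smul, neg_smul, sub_neg_eq_add,
    neg_add_eq_sub]

theorem commute_ribbonForm_F (ε : ℤˣ) : Commute (ribbonForm r ε) (F r) := by
  obtain ⟨n, hn⟩ : ∃ n, r₁ r = n + 1 := Nat.exists_eq_succ_of_ne_zero (r₁_pos r).ne'
  have htop : F r ^ (n + 1) = 0 := hn ▸ F_pow_r₁ r
  have hmul_F := sum_range_succ_of_telescoping (n := n) (t := fun a => ribbonCoeff r ε a •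
    (F r ^ a * E r ^ a * cartan r (-(ε * (a + 1))) (-ε)) * F r)
    (G := fun a => (ribbonCoeff r ε a * q r ^ (2 * (ε * a) : ℤ)) •
      (F r ^ (a + 1) * E r ^ a * cartan r (-(ε * (a - 1))) (-ε)))
    (by
      rw [smul_mul_assoc, mul_assoc, cartan_neg_units_mul_F]
      simp) fun a ha => ribbonCoeff_succ_smul_mul_F r ε (by omega)
  rw [Commute, SemiconjBy, ribbonForm, hn, Finset.sum_mul, hmul_F, Finset.mul_sum,
    Finset.sum_range_succ]
  simp only [mul_smul_comm, ← mul_assoc, ← pow_succ', htop, zero_mul, smul_zero]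

theorem qInt_succ_div_qFact_succ {a : ℕ} (ha : a + 1 < r₁ r) :
    qInt r (a + 1 : ℕ) / qFact r (a + 1) = (qFact r a)⁻¹ := by
  rw [qFact_succ, ← Nat.cast_succ, mul_comm, div_mul_cancel_left₀ (qInt_ne_zero r a.succ_pos ha)]

theorem sum_antidiagonal_inv_qFact_mul_qFact (ε : ℤˣ) {n : ℕ} (hn : n + 1 < r₁ r) :
    ∑ x ∈ antidiagonal (n + 1), (-1) ^ x.1 * q r ^ (-(ε * (x.1 * n)) : ℤ) /
      (qFact r x.1 * qFact r x.2) = 0 := by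
  have hq := q_ne_zero r
  refine (mul_eq_zero.1 ?_).resolve_left (qInt_ne_zero r n.succ_pos hn)
  have hsplit : ∀ x ∈ antidiagonal (n + 1), qInt r (n + 1 : ℕ) *
      ((-1) ^ x.1 * q r ^ (-(ε * (x.1 * n)) : ℤ) / (qFact r x.1 * qFact r x.2)) =
      (-1) ^ x.1 * q r ^ (ε * (x.2 - x.1 * n) : ℤ) * (qInt r x.1 / qFact r x.1) / qFact r x.2 +
      (-1) ^ x.1 * q r ^ (-(ε * (x.1 * (n + 1))) : ℤ) * (qInt r x.2 / qFact r x.2) /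
        qFact r x.1 := by
    intro x hx
    rw [← mem_antidiagonal.1 hx, Nat.cast_add, qInt_add r ε,
      show (ε * (x.2 - x.1 * n) : ℤ) = ε * x.2 + -(ε * (x.1 * n)) by ring,
      show (-(ε * (x.1 * (n + 1))) : ℤ) = -(ε * x.1) + -(ε * (x.1 * n)) by ring,
      zpow_add₀ hq, zpow_add₀ hq]
    ring
  rw [Finset.mul_sum, Finset.sum_congr rfl hsplit, Finset.sum_add_distrib,
    Finset.Nat.sum_antidiagonal_succ, Finset.Nat.sum_antidiagonal_succ']
  simp only [Nat.cast_zero, qInt_zero, zero_div, mul_zero, zero_add]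
  rw [← Finset.sum_add_distrib]
  refine Finset.sum_eq_zero fun x hx => ?_
  have hx' := mem_antidiagonal.1 hx
  rw [qInt_succ_div_qFact_succ r (by omega), qInt_succ_div_qFact_succ r (by omega),
    show (ε * (x.2 - (x.1 + 1 : ℕ) * n) : ℤ) = -(ε * (x.1 * (n + 1))) by
      rw [← hx']; push_cast; ring, pow_succ]
  ring

theorem sum_sum_smul_eq_sum_antidiagonal {R M : Type*} [Semiring R] [AddCommMonoid M] [Module R M]
    (N : ℕ) (x : ℕ → ℕ → R) {W : ℕ → M} (hW : ∀ n, N ≤ n → W n = 0) :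
    ∑ a ∈ Finset.range N, ∑ b ∈ Finset.range N, x a b • W (a + b) =
      ∑ n ∈ Finset.range N, (∑ y ∈ antidiagonal n, x y.1 y.2) • W n := by
  have hrange (a : ℕ) : ∑ b ∈ Finset.range N, x a b • W (a + b) =
      ∑ b ∈ Finset.range (N - a), x a b • W (a + b) :=
    (Finset.sum_subset (Finset.range_subset_range.2 (Nat.sub_le _ _)) fun b _ hb => by
      rw [hW _ (by simpa [add_comm] using hb), smul_zero]).symm
  rw [Finset.sum_congr rfl fun a _ => hrange a,
    ← Finset.sum_range_diag_flip N fun a b => x a b • W (a + b)]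
  refine Finset.sum_congr rfl fun n _ => ?_
  rw [Finset.Nat.sum_antidiagonal_eq_sum_range_succ x, Finset.sum_smul]
  refine Finset.sum_congr rfl fun k hk => ?_
  rw [Nat.add_sub_cancel' (Nat.lt_succ_iff.1 (Finset.mem_range.1 hk))]

theorem F_pow_mul_term_mul_E_pow_mul_cartan (a b : ℕ) (m m' n : ℤ) :
    F r ^ a * (F r ^ b * E r ^ b * cartan r m n) * E r ^ a * cartan r m' (-n) =
      q r ^ (2 * (m * a + n * a ^ 2)) •
        (F r ^ (a + b) * E r ^ (a + b) * (K r ^ (m + 2 * n * a + m')).val) := by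
  calc _ = F r ^ (a + b) * (E r ^ b * (cartan r m n * E r ^ a * cartan r m' (-n))) := by
        simp only [pow_add, mul_assoc]
    _ = _ := by
        rw [cartan_mul_E_pow, smul_mul_assoc, mul_assoc, cartan_mul_cartan, add_neg_cancel,
          cartan_zero_right, mul_smul_comm, mul_smul_comm, ← mul_assoc (E r ^ b), ← pow_add,
          add_comm b, ← mul_assoc (F r ^ (a + b))]

theorem sum_antidiagonal_ribbonCoeff (ε : ℤˣ) {n : ℕ} (hn : n + 1 < r₁ r) :
    ∑ x ∈ antidiagonal (n + 1), ribbonCoeff r (-ε) x.1 * ribbonCoeff r ε x.2 *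
      q r ^ (-(2 * (ε * (x.1 * (x.1 + x.2 + 1)))) : ℤ) = 0 := by
  simp only [ribbonCoeff_neg_mul_ribbonCoeff]
  rw [← mul_zero (brace r (-ε) ^ (n + 1) *
      q r ^ (-(ε * (((n + 1 : ℕ) + 3) * (n + 1 : ℕ) / 2)) : ℤ)),
    ← sum_antidiagonal_inv_qFact_mul_qFact r ε hn, Finset.mul_sum]
  refine Finset.sum_congr rfl fun x hx => ?_
  have hx' := mem_antidiagonal.1 hx
  rw [hx', show (x.1 + x.2 - 1 : ℤ) = n by omega]

theorem ribbonForm_mul_ribbonForm_neg (ε : ℤˣ) : ribbonForm r ε * ribbonForm r (-ε) = 1 := by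
  have hF (n : ℕ) (hn : r₁ r ≤ n) : F r ^ n * E r ^ n * (K r ^ (-(ε * n) : ℤ)).val = 0 := by
    rw [← Nat.sub_add_cancel hn, pow_add (F r), F_pow_r₁, mul_zero, zero_mul, zero_mul]
  calc ribbonForm r ε * ribbonForm r (-ε)
    _ = ∑ a ∈ Finset.range (r₁ r), ∑ b ∈ Finset.range (r₁ r), (ribbonCoeff r (-ε) a *
          ribbonCoeff r ε b * q r ^ (-(2 * (ε * (a * (a + b + 1)))) : ℤ)) •
            (F r ^ (a + b) * E r ^ (a + b) * (K r ^ (-(ε * (a + b : ℕ)) : ℤ)).val) := by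
      nth_rewrite 2 [ribbonForm]
      rw [Finset.mul_sum]
      refine Finset.sum_congr rfl fun a _ => ?_
      rw [mul_smul_comm, ← mul_assoc, ← mul_assoc,
        ((commute_ribbonForm_F r ε).pow_right a).eq, ribbonForm]
      simp only [Finset.mul_sum, Finset.sum_mul, Finset.smul_sum]
      refine Finset.sum_congr rfl fun b _ => ?_
      rw [mul_smul_comm, smul_mul_assoc, smul_mul_assoc, Units.val_neg,
        F_pow_mul_term_mul_E_pow_mul_cartan, smul_smul, smul_smul]
      push_cast
      ring_nf
    _ = ∑ n ∈ Finset.range (r₁ r), (∑ y ∈ antidiagonal n, ribbonCoeff r (-ε) y.1 *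
          ribbonCoeff r ε y.2 * q r ^ (-(2 * (ε * (y.1 * (y.1 + y.2 + 1)))) : ℤ)) •
            (F r ^ n * E r ^ n * (K r ^ (-(ε * n) : ℤ)).val) :=
      sum_sum_smul_eq_sum_antidiagonal _ _ hF
    _ = 1 := by
      rw [Finset.sum_eq_single_of_mem 0 (Finset.mem_range.2 (r₁_pos r)) fun n hn hn0 => ?_]
      · simp [ribbonCoeff, qFact]
      obtain ⟨n, rfl⟩ := Nat.exists_eq_succ_of_ne_zero hn0
      rw [sum_antidiagonal_ribbonCoeff r ε (Finset.mem_range.1 hn), zero_smul]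

/-- The ribbon element `v₊` as a unit, with inverse `v₋`. -/
def ribbonUnit : (SmallQuantumSl2 r)ˣ where
  val := ribbonForm r 1
  inv := ribbonForm r (-1)
  val_inv := ribbonForm_mul_ribbonForm_neg r 1
  inv_val := by simpa using ribbonForm_mul_ribbonForm_neg r (-1)

end

/-! ### The closed forms -/

theorem isPrimitiveRoot_q {r : ℕ} (hr : r ≠ 0) : IsPrimitiveRoot (q r) r :=
  Complex.isPrimitiveRoot_exp r hr

theorem sum_q_sq_zpow_eq_quadGaussSum {r N : ℕ} (hr : r ≠ 0) (hN : N ≠ 0) {n m : ℤ}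
    (h : 4 * n * N = m * r) :
    ∑ c ∈ Finset.range N, (q r ^ (2 : ℤ)) ^ (n * (c : ℤ) ^ 2) = quadGaussSum m N := by
  have hr' : (r : ℂ) ≠ 0 := Nat.cast_ne_zero.2 hr
  have hN' : (N : ℂ) ≠ 0 := Nat.cast_ne_zero.2 hN
  have h' : 4 * (n : ℂ) * N = m * r := by exact_mod_cast h
  refine Finset.sum_congr rfl fun c _ => ?_
  rw [← zpow_mul, q, ← Complex.exp_int_mul]
  congr 1
  push_cast
  field_simp
  linear_combination (c : ℂ) ^ 2 * h'

theorem r₁_of_odd {r : ℕ} (h : r % 2 = 1) : r₁ r = r := by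
  rw [r₁, Nat.coprime_two_right.2 (Nat.odd_iff.2 h), Nat.div_one]

theorem two_mul_r₁_of_even {r : ℕ} (h : r % 2 = 0) : 2 * r₁ r = r := by
  rw [r₁, Nat.gcd_eq_right (Nat.dvd_of_mod_eq_zero h), Nat.mul_div_cancel' (by omega)]

theorem four_mul_r₂_of_four_dvd {r : ℕ} (h : r % 4 = 0) : 4 * r₂ r = r := by
  rw [r₂, Nat.gcd_eq_right (Nat.dvd_of_mod_eq_zero h), Nat.mul_div_cancel' (by omega)]

theorem ribbonForm_eq_of_gaussianElement_eq (r : ℕ) (ε : ℤˣ) {ι : Type*} {s : Finset ι}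
    {f g : ι → ℤ} {z : ℂ} (h : gaussianElement (q r ^ (2 : ℤ)) (r₁ r) (K r) (-ε : ℤ) =
      z • ∑ i ∈ s, (q r ^ (2 : ℤ)) ^ f i • (K r ^ g i).val) :
    ribbonForm r ε = z • ∑ a ∈ Finset.range (r₁ r), ∑ i ∈ s,
      (brace r (-ε) ^ a / qFact r a * q r ^ (-(ε * (((a : ℤ) + 3) * a / 2)) + 2 * f i)) •
        (F r ^ a * E r ^ a * (K r ^ (-(ε * (a + 1)) + g i : ℤ)).val) := by
  rw [ribbonForm, Finset.smul_sum]
  refine Finset.sum_congr rfl fun a _ => ?_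
  simp only [cartan, h, mul_smul_comm, Finset.mul_sum, Finset.smul_sum, smul_smul, ribbonCoeff,
    ← Units.val_mul, ← zpow_add]
  refine Finset.sum_congr rfl fun i _ => ?_
  rw [zpow_add₀ (q_ne_zero r), zpow_mul (q r)]
  ring_nf

section

variable {r : ℕ} [Fact (2 < r)] (ε : ℤˣ)

theorem ribbonForm_of_odd (h : r % 2 = 1) :
    ribbonForm r ε = (Complex.I ^ (ε * (((r : ℤ) - 1) / 2)) / (√(r : ℝ) : ℂ)) •
      ∑ a ∈ Finset.range r, ∑ b ∈ Finset.range r,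
        (brace r (-ε) ^ a / qFact r a * q r ^ (-(ε * (((a : ℤ) + 3) * a / 2)) +
          ε * (((r : ℤ) + 1) / 2 * ((b : ℤ) + ε) ^ 2))) •
          (F r ^ a * E r ^ a * (K r ^ (-(ε * (a : ℤ)) + b)).val) := by
  have hr₁ := r₁_of_odd h
  obtain ⟨t, ht⟩ : ∃ t : ℤ, t = ((r : ℤ) + 1) / 2 := ⟨_, rfl⟩
  have hrt : (r : ℤ) = 2 * t - 1 := by omega
  have hsum := sum_q_sq_zpow_eq_quadGaussSum (by omega : r ≠ 0) (by omega : r ≠ 0)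
    (n := (-ε : ℤˣ)) (m := (-ε : ℤˣ) * 4) (by ring)
  have hζ := q_sq_primitive r
  have hK := K_pow_r₁ r
  rw [hr₁] at hζ hK
  have hγ := gaussianElement_eq_of_odd hζ hK hrt (-ε) ε
  rw [hsum, quadGaussSum_units_mul_four (Nat.odd_iff.2 h), inv_natCast_mul_sqrt_mul,
    Units.val_neg, neg_mul, neg_neg] at hγ
  rw [ribbonForm_eq_of_gaussianElement_eq r ε (by rw [hr₁]; exact hγ), hr₁, ← ht]
  congr 1
  refine Finset.sum_congr rfl fun a _ => Finset.sum_congr rfl fun b _ => ?_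
  congr 2
  · refine zpow_eq_zpow_of_modEq (isPrimitiveRoot_q (by omega))
      (Int.modEq_iff_dvd.2 ⟨-(ε * t * (b + ε) ^ 2), ?_⟩)
    rw [hrt]
    ring
  · ring_nf

theorem ribbonForm_of_mod_four (h : r % 4 = 2) :
    ribbonForm r ε = ((jacobiSym 2 (r₁ r) : ℂ) *
        (Complex.I ^ (ε * (((r₁ r : ℤ) - 1) / 2)) / (√(r₁ r : ℝ) : ℂ))) •
      ∑ a ∈ Finset.range (r₁ r), ∑ b ∈ Finset.range (r₁ r),
        (brace r (-ε) ^ a / qFact r a * q r ^ (-(ε * (((a : ℤ) + 3) * a / 2)) +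
          ε * (((r₁ r : ℤ) + 1) ^ 2 / 2 * ((b : ℤ) + ε) ^ 2))) •
          (F r ^ a * E r ^ a * (K r ^ (-(ε * (a : ℤ)) + b)).val) := by
  have hr₁ := two_mul_r₁_of_even (r := r) (by omega)
  obtain ⟨t, hrt⟩ : ∃ t : ℤ, (r₁ r : ℤ) = 2 * t - 1 := ⟨((r₁ r : ℤ) + 1) / 2, by omega⟩
  have ht : ((r₁ r : ℤ) + 1) ^ 2 / 2 = 2 * t ^ 2 := by
    rw [hrt, show (2 * t - 1 + 1) ^ 2 = 2 * (2 * t ^ 2) by ring,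
      Int.mul_ediv_cancel_left _ two_ne_zero]
  have hsum := sum_q_sq_zpow_eq_quadGaussSum (by omega : r ≠ 0) (r₁_pos r).ne'
    (n := (-ε : ℤˣ)) (m := (-ε : ℤˣ) * 2)
    (by linear_combination 2 * ((-ε : ℤˣ) : ℤ) * (by exact_mod_cast hr₁ : 2 * (r₁ r : ℤ) = r))
  have hγ := gaussianElement_eq_of_odd (q_sq_primitive r) (K_pow_r₁ r) hrt (-ε) ε
  rw [hsum, quadGaussSum_units_mul_two_of_odd (Nat.odd_iff.2 (by omega)),
    inv_natCast_mul_sqrt_mul, Units.val_neg, neg_mul, neg_neg] at hγ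
  rw [ribbonForm_eq_of_gaussianElement_eq r ε hγ, ht, mul_div_assoc]
  congr 1
  refine Finset.sum_congr rfl fun a _ => Finset.sum_congr rfl fun b _ => ?_
  ring_nf

theorem ribbonForm_of_mod_eight (h : r % 8 = 4) :
    ribbonForm r ε = (Complex.I ^ (ε * (((r₂ r : ℤ) - 1) / 2)) / (√(r₂ r : ℝ) : ℂ)) •
      ∑ a ∈ Finset.range (r₁ r), ∑ b ∈ Finset.range (r₂ r),
        (brace r (-ε) ^ a / qFact r a * q r ^ (-(ε * (((a : ℤ) + 3) * a / 2)) +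
          ε * (((r₂ r : ℤ) + 1) ^ 3 / 2 * (2 * (b : ℤ) + ε) ^ 2))) •
          (F r ^ a * E r ^ a * (K r ^ (-(ε * (a : ℤ)) + 2 * b)).val) := by
  have hr₁ := two_mul_r₁_of_even (r := r) (by omega)
  have hr₂ := four_mul_r₂_of_four_dvd (r := r) (by omega)
  have hr₁₂ : r₁ r = 2 * r₂ r := by omega
  obtain ⟨t, hrt⟩ : ∃ t : ℤ, (r₂ r : ℤ) = 2 * t - 1 := ⟨((r₂ r : ℤ) + 1) / 2, by omega⟩
  have ht : ((r₂ r : ℤ) + 1) ^ 3 / 2 = 4 * t ^ 3 := by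
    rw [hrt, show (2 * t - 1 + 1) ^ 3 = 2 * (4 * t ^ 3) by ring,
      Int.mul_ediv_cancel_left _ two_ne_zero]
  have hsum := sum_q_sq_zpow_eq_quadGaussSum (by omega : r ≠ 0) (by omega : r₂ r ≠ 0)
    (n := 4 * (-ε : ℤˣ)) (m := (-ε : ℤˣ) * 4)
    (by linear_combination 4 * ((-ε : ℤˣ) : ℤ) * (by exact_mod_cast hr₂ : 4 * (r₂ r : ℤ) = r))
  have hγ := gaussianElement_eq_of_two_mul_odd (hr₁₂ ▸ q_sq_primitive r) (hr₁₂ ▸ K_pow_r₁ r) hrt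
    (-ε) (odd_units_int ε)
  rw [hsum, quadGaussSum_units_mul_four (Nat.odd_iff.2 (by omega)), inv_natCast_mul_sqrt_mul,
    ← hr₁₂, Units.val_neg, neg_mul, neg_neg] at hγ
  rw [ribbonForm_eq_of_gaussianElement_eq r ε hγ, ht]
  congr 1
  refine Finset.sum_congr rfl fun a _ => Finset.sum_congr rfl fun b _ => ?_
  ring_nf

theorem two_pow_mul_dvd_mul_add_pow_sub_one {k s ψ : ℕ} (hs : Odd s)
    (hψ : s * ψ ≡ 1 [MOD 2 ^ (k - 1)]) :
    (2 : ℤ) ^ (k - 1) * s ∣ s * ψ + (s + 1) ^ (k + 1) - 1 := by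
  have hcoprime : IsCoprime ((2 : ℤ) ^ (k - 1)) s :=
    IsCoprime.pow_left (by exact_mod_cast Nat.isCoprime_iff_coprime.2 (Nat.coprime_two_left.2 hs))
  refine hcoprime.mul_dvd ?_ ?_
  · have hdvd : (2 : ℤ) ^ (k - 1) ∣ s * ψ - 1 := by exact_mod_cast Nat.modEq_iff_dvd.1 hψ.symm
    have hdvd' : (2 : ℤ) ^ (k - 1) ∣ (s + 1) ^ (k + 1) :=
      (pow_dvd_pow 2 (by omega)).trans
        (pow_dvd_pow_of_dvd (by exact_mod_cast hs.add_one.two_dvd) _)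
    rw [add_sub_right_comm]
    exact dvd_add hdvd hdvd'
  · have hdvd : (s : ℤ) ∣ (s + 1) ^ (k + 1) - 1 := by
      simpa using sub_dvd_pow_sub_pow ((s : ℤ) + 1) 1 (k + 1)
    rw [add_sub_assoc]
    exact dvd_add (dvd_mul_right _ _) hdvd

theorem gaussianElement_of_eight_dvd (h : 8 ∣ r) :
    gaussianElement (q r ^ (2 : ℤ)) (r₁ r) (K r) (-ε : ℤ) =
      ((1 - (ε : ℤ) * Complex.I) / ((√2 : ℝ) * (√(r₂ r : ℝ) : ℝ) : ℂ)) •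
        ∑ b ∈ Finset.range (r₂ r),
          (q r ^ (2 : ℤ)) ^ ((ε : ℤ) * b ^ 2) • (K r ^ (2 * b : ℤ)).val := by
  have hr₁ := two_mul_r₁_of_even (r := r) (by omega)
  have hr₂ := four_mul_r₂_of_four_dvd (r := r) (by omega)
  have hr₁₂ : r₁ r = 2 * r₂ r := by omega
  have hpos := r₁_pos r
  have hsqrt : (√(r₁ r : ℝ) : ℂ) = (√2 : ℝ) * (√(r₂ r : ℝ) : ℝ) := by
    rw [hr₁₂, Nat.cast_mul, Nat.cast_ofNat, Real.sqrt_mul zero_le_two, Complex.ofReal_mul]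
  have hsum := sum_q_sq_zpow_eq_quadGaussSum (by omega : r ≠ 0) hpos.ne'
    (n := (-ε : ℤˣ)) (m := (-ε : ℤˣ) * 2)
    (by linear_combination 2 * ((-ε : ℤˣ) : ℤ) * (by exact_mod_cast hr₁ : 2 * (r₁ r : ℤ) = r))
  have hγ := gaussianElement_eq_of_two_mul_even (hr₁₂ ▸ q_sq_primitive r) (hr₁₂ ▸ K_pow_r₁ r)
    (by omega) (Nat.even_iff.2 (by omega)) (-ε)
  rw [← hr₁₂, hsum, quadGaussSum_units_mul_two_of_four_dvd hpos (by omega),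
    inv_natCast_mul_sqrt_mul, hsqrt, Units.val_neg, Int.cast_neg, neg_mul, ← sub_eq_add_neg] at hγ
  simpa only [neg_mul, neg_neg] using hγ

theorem ribbonForm_of_eight_dvd {k s ψ : ℕ} (hk : 3 ≤ k) (hs : Odd s) (hrk : r = 2 ^ k * s)
    (hψ : s * ψ ≡ 1 [MOD 2 ^ (k - 1)]) :
    ribbonForm r ε = ((1 - (ε : ℤ) * Complex.I) / ((√2 : ℝ) * (√(r₂ r : ℝ) : ℝ) : ℂ)) •
      ∑ a ∈ Finset.range (r₁ r), ∑ b ∈ Finset.range s, ∑ m ∈ Finset.range (2 ^ (k - 2)),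
        (brace r (-ε) ^ a / qFact r a * q r ^ (-(ε * (((a : ℤ) + 3) * a / 2)) +
          ε * (2 * ((s : ℤ) * ψ + ((s : ℤ) + 1) ^ (k + 1)) *
            (2 ^ (k - 2) * (b : ℤ) + m) ^ 2))) •
          (F r ^ a * E r ^ a *
            (K r ^ (-(ε * (a : ℤ)) + 2 ^ (k - 1) * b + 2 * m - ε)).val) := by
  obtain ⟨y, hy⟩ := two_pow_mul_dvd_mul_add_pow_sub_one hs hψ
  obtain ⟨j, rfl⟩ : ∃ j, k = j + 3 := ⟨k - 3, by omega⟩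
  simp only [show j + 3 - 1 = j + 2 by omega, show j + 3 - 2 = j + 1 by omega] at hy ⊢
  have hr8 : 8 ∣ r := hrk ▸ (pow_dvd_pow 2 hk).mul_right s
  have hr₂s : r₂ r = 2 ^ (j + 1) * s := by
    have hr₂ := four_mul_r₂_of_four_dvd (r := r) (by omega)
    refine mul_left_cancel₀ four_ne_zero (hr₂.trans (hrk.trans ?_))
    ring
  rw [ribbonForm_eq_of_gaussianElement_eq r ε (gaussianElement_of_eight_dvd ε hr8)]
  congr 1
  refine Finset.sum_congr rfl fun a _ => ?_
  rw [hr₂s, sum_range_mul]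
  refine Finset.sum_congr rfl fun b _ => Finset.sum_congr rfl fun m _ => ?_
  push_cast
  congr 2
  · refine zpow_eq_zpow_of_modEq (isPrimitiveRoot_q (pos_of_gt (Fact.out : 2 < r)).ne')
      (Int.modEq_iff_dvd.2 ⟨ε * y * (2 ^ (j + 1) * (b : ℤ) + m) ^ 2, ?_⟩)
    rw [hrk]
    push_cast
    linear_combination 2 * ε * (2 ^ (j + 1) * (b : ℤ) + m) ^ 2 * hy
  · ring_nf

end

end SmallQuantum

end

open SmallQuantum in
theorem lemmaL (r : ℕ) [Fact (2 < r)] :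
    ∃ v : (SmallQuantumSl2 r)ˣ, (v : SmallQuantumSl2 r) = ribbonElement r ∧
      (r % 2 = 1 →
        (v : SmallQuantumSl2 r) =
          (Complex.I ^ (((r : ℤ) - 1) / 2) / (√(r : ℝ) : ℂ)) •
            ∑ a ∈ Finset.range r, ∑ b ∈ Finset.range r,
              (brace r (-1) ^ a / qFact r a *
                q r ^ (-(((a : ℤ) + 3) * a / 2) + ((r : ℤ) + 1) / 2 * ((b : ℤ) + 1) ^ 2)) •
                (F r ^ a * E r ^ a * (K r ^ (-(a : ℤ) + b) : (SmallQuantumSl2 r)ˣ)) ∧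
        ((v⁻¹ : (SmallQuantumSl2 r)ˣ) : SmallQuantumSl2 r) =
          (Complex.I ^ (-(((r : ℤ) - 1) / 2)) / (√(r : ℝ) : ℂ)) •
            ∑ a ∈ Finset.range r, ∑ b ∈ Finset.range r,
              (brace r 1 ^ a / qFact r a *
                q r ^ (((a : ℤ) + 3) * a / 2 - ((r : ℤ) + 1) / 2 * ((b : ℤ) - 1) ^ 2)) •
                (F r ^ a * E r ^ a * (K r ^ ((a : ℤ) + b) : (SmallQuantumSl2 r)ˣ))) ∧
      (r % 4 = 2 →
        (v : SmallQuantumSl2 r) =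
          ((jacobiSym 2 (r₁ r) : ℂ) *
              (Complex.I ^ (((r₁ r : ℤ) - 1) / 2) / (√(r₁ r : ℝ) : ℂ))) •
            ∑ a ∈ Finset.range (r₁ r), ∑ b ∈ Finset.range (r₁ r),
              (brace r (-1) ^ a / qFact r a *
                q r ^ (-(((a : ℤ) + 3) * a / 2)
                  + ((r₁ r : ℤ) + 1) ^ 2 / 2 * ((b : ℤ) + 1) ^ 2)) •
                (F r ^ a * E r ^ a * (K r ^ (-(a : ℤ) + b) : (SmallQuantumSl2 r)ˣ)) ∧
        ((v⁻¹ : (SmallQuantumSl2 r)ˣ) : SmallQuantumSl2 r) =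
          ((jacobiSym 2 (r₁ r) : ℂ) *
              (Complex.I ^ (-(((r₁ r : ℤ) - 1) / 2)) / (√(r₁ r : ℝ) : ℂ))) •
            ∑ a ∈ Finset.range (r₁ r), ∑ b ∈ Finset.range (r₁ r),
              (brace r 1 ^ a / qFact r a *
                q r ^ (((a : ℤ) + 3) * a / 2
                  - ((r₁ r : ℤ) + 1) ^ 2 / 2 * ((b : ℤ) - 1) ^ 2)) •
                (F r ^ a * E r ^ a * (K r ^ ((a : ℤ) + b) : (SmallQuantumSl2 r)ˣ))) ∧
      (r % 8 = 4 →
        (v : SmallQuantumSl2 r) =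
          (Complex.I ^ (((r₂ r : ℤ) - 1) / 2) / (√(r₂ r : ℝ) : ℂ)) •
            ∑ a ∈ Finset.range (r₁ r), ∑ b ∈ Finset.range (r₂ r),
              (brace r (-1) ^ a / qFact r a *
                q r ^ (-(((a : ℤ) + 3) * a / 2)
                  + ((r₂ r : ℤ) + 1) ^ 3 / 2 * (2 * (b : ℤ) + 1) ^ 2)) •
                (F r ^ a * E r ^ a * (K r ^ (-(a : ℤ) + 2 * b) : (SmallQuantumSl2 r)ˣ)) ∧
        ((v⁻¹ : (SmallQuantumSl2 r)ˣ) : SmallQuantumSl2 r) =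
          (Complex.I ^ (-(((r₂ r : ℤ) - 1) / 2)) / (√(r₂ r : ℝ) : ℂ)) •
            ∑ a ∈ Finset.range (r₁ r), ∑ b ∈ Finset.range (r₂ r),
              (brace r 1 ^ a / qFact r a *
                q r ^ (((a : ℤ) + 3) * a / 2
                  - ((r₂ r : ℤ) + 1) ^ 3 / 2 * (2 * (b : ℤ) - 1) ^ 2)) •
                (F r ^ a * E r ^ a * (K r ^ ((a : ℤ) + 2 * b) : (SmallQuantumSl2 r)ˣ))) ∧
      (∀ k s ψ : ℕ, 3 ≤ k → Odd s → r = 2 ^ k * s → s * ψ ≡ 1 [MOD 2 ^ (k - 1)] →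
        (v : SmallQuantumSl2 r) =
          ((1 - Complex.I) / ((√2 : ℝ) * (√(r₂ r : ℝ) : ℝ) : ℂ)) •
            ∑ a ∈ Finset.range (r₁ r), ∑ b ∈ Finset.range s, ∑ m ∈ Finset.range (2 ^ (k - 2)),
              (brace r (-1) ^ a / qFact r a *
                q r ^ (-(((a : ℤ) + 3) * a / 2)
                  + 2 * ((s : ℤ) * ψ + ((s : ℤ) + 1) ^ (k + 1))
                    * (2 ^ (k - 2) * (b : ℤ) + m) ^ 2)) •
                (F r ^ a * E r ^ a *
                  (K r ^ (-(a : ℤ) + 2 ^ (k - 1) * b + 2 * m - 1) : (SmallQuantumSl2 r)ˣ)) ∧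
        ((v⁻¹ : (SmallQuantumSl2 r)ˣ) : SmallQuantumSl2 r) =
          ((1 + Complex.I) / ((√2 : ℝ) * (√(r₂ r : ℝ) : ℝ) : ℂ)) •
            ∑ a ∈ Finset.range (r₁ r), ∑ b ∈ Finset.range s, ∑ m ∈ Finset.range (2 ^ (k - 2)),
              (brace r 1 ^ a / qFact r a *
                q r ^ (((a : ℤ) + 3) * a / 2
                  - 2 * ((s : ℤ) * ψ + ((s : ℤ) + 1) ^ (k + 1))
                    * (2 ^ (k - 2) * (b : ℤ) + m) ^ 2)) •
                (F r ^ a * E r ^ a *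
                  (K r ^ ((a : ℤ) + 2 ^ (k - 1) * b + 2 * m + 1) : (SmallQuantumSl2 r)ˣ))) := by
  refine ⟨ribbonUnit r, (ribbonElement_eq_ribbonForm r).symm, fun h => ⟨?_, ?_⟩,
    fun h => ⟨?_, ?_⟩, fun h => ⟨?_, ?_⟩, fun k s ψ hk hs hr hψ => ⟨?_, ?_⟩⟩
  · simpa [ribbonUnit, sub_eq_add_neg] using ribbonForm_of_odd 1 h
  · simpa [ribbonUnit, sub_eq_add_neg] using ribbonForm_of_odd (-1) h
  · simpa [ribbonUnit, sub_eq_add_neg] using ribbonForm_of_mod_four 1 h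
  · simpa [ribbonUnit, sub_eq_add_neg] using ribbonForm_of_mod_four (-1) h
  · simpa [ribbonUnit, sub_eq_add_neg] using ribbonForm_of_mod_eight 1 h
  · simpa [ribbonUnit, sub_eq_add_neg] using ribbonForm_of_mod_eight (-1) h
  · simpa [ribbonUnit, sub_eq_add_neg] using ribbonForm_of_eight_dvd 1 hk hs hr hψ
  · simpa [ribbonUnit, sub_eq_add_neg] using ribbonForm_of_eight_dvd (-1) hk hs hr hψ
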